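/- Let $k\ge 1$, let $S_k$ be the set of symmetric positive definite real $k\times k$ matrices and $M_k$ the set of all real $k\times k$ matrices. For $\mathcal V=(\mu,\Sigma,\nu)\in\mathbb R^k\times S_k\times(0,\infty)$ let $$f_{\mathcal V}(x)=\frac{\Gamma(\frac{\nu+k}{2})}{(\pi\nu)^{k/2}\,\Gamma(\frac{\nu}{2})}\,|\Sigma|^{-1/2}\Bigl(1+\tfrac1\nu (x-\mu)'\Sigma^{-1}(x-\mu)\Bigr)^{-(\nu+k)/2},\qquad x\in\mathbb R^k,$$ be the $k$-variate Student $t$ density, and let $\mathrm P^{(n)}_{\mathcal V}$ be the joint law of $n$ i.i.d. observations $X_1,\dots,X_n$ with density $f_{\mathcal V}$. For $A\in M_k$ let $\mathrm{vech}(A)\in\mathbb R^{k(k+1)/2}$ be the vector of the entries of $A$ on and above the diagonal. Let $\mathcal L_{\mathcal V}(x)$ be the score vector, i.e. the gradient of $\log f_{\mu,\Sigma,\nu}(x)$ with respect to $(\mu',(\mathrm{vech}\,\Sigma)',\nu)'$, let $$\Delta^{(n)}(\mathcal V)=n^{-1/2}\sum_{i=1}^n\mathcal L_{\mathcal V}(X_i),$$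 and let the Fisher information matrix $\Gamma(\mathcal V)$ be the covariance matrix of $\mathcal L_{\mathcal V}(X_1)$ under $\mathrm P^{(1)}_{\mathcal V}$. Theorem. For every $\mu\in\mathbb R^k$, $\Sigma\in S_k$ and $\nu>0$, the Student $t$ family is uniformly locally asymptotically normal (ULAN) at $\mathcal V=(\mu,\Sigma,\nu)$ with central sequence $\Delta^{(n)}(\mathcal V)$ and information matrix $\Gamma(\mathcal V)$. Precisely: $\Gamma(\mathcal V)$ is finite (the score is square integrable), symmetric and non-singular (hence positive definite), and for every sequence $\mathcal V^{(n)}=(\mu^{(n)},\Sigma^{(n)},\nu^{(n)})\in\mathbb R^k\times S_k\times(0,\infty)$ with $\mathcal V^{(n)}=\mathcal V+O(n^{-1/2})$ and every bounded sequence $\tau^{(n)}=(\tau^{(n)}_1,\tau^{(n)}_2,\tau^{(n)}_3)\in\mathbb R^k\times M_k\times\mathbb R$ such that $\Sigma^{(n)}+n^{-1/2}\tau^{(n)}_2\in S_k$ and $\nu^{(n)}+n^{-1/2}\tau^{(n)}_3>0$ for all $n$, writing $\mathcal T^{(n)}=((\tau^{(n)}_1)',(\mathrm{vech}\,\tau^{(n)}_2)',\tau^{(n)}_3)'$,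 the law $\mathrm P^{(n)}_{\mathcal V^{(n)}+n^{-1/2}\tau^{(n)}}$ is absolutely continuous with respect to $\mathrm P^{(n)}_{\mathcal V^{(n)}}$, $$\log\frac{\mathrm d\mathrm P^{(n)}_{\mathcal V^{(n)}+n^{-1/2}\tau^{(n)}}}{\mathrm d\mathrm P^{(n)}_{\mathcal V^{(n)}}}=(\mathcal T^{(n)})'\Delta^{(n)}(\mathcal V^{(n)})-\tfrac12(\mathcal T^{(n)})'\,\Gamma(\mathcal V)\,\mathcal T^{(n)}+o_{\mathrm P}(1),$$ and $$\Delta^{(n)}(\mathcal V^{(n)})\xrightarrow{\ \mathcal L\ }\mathcal N_{k+k(k+1)/2+1}\bigl(0,\Gamma(\mathcal V)\bigr),$$ both under $\mathrm P^{(n)}_{\mathcal V^{(n)}}$ as $n\to\infty$. -/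

import Mathlib

open MeasureTheory ProbabilityTheory Filter Topology Asymptotics
open scoped Matrix

namespace StudentT

noncomputable section

/-- Triples `(location, scatter, tail)` in `ℝ^k × M_k × ℝ`, with componentwise operations. -/
abbrev Triple (k : ℕ) : Type :=
  EuclideanSpace ℝ (Fin k) × Matrix (Fin k) (Fin k) ℝ × ℝ

/-- The parameter space: scatter symmetric positive definite, tail weight positive. -/
def paramSpace (k : ℕ) : Set (Triple k) :=
  {V | V.2.1.PosDef ∧ 0 < V.2.2}

/-- Positions on or above the diagonal of a `k × k` matrix, the index set of `vech`. -/
abbrev UpperIdx (k : ℕ) : Type := {p : Fin k × Fin k // p.1 ≤ p.2}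

/-- Index set of the coordinates `(μ, vech Σ, ν)`; it has `k + k (k + 1) / 2 + 1` elements. -/
abbrev CoordIdx (k : ℕ) : Type := Fin k ⊕ UpperIdx k ⊕ Unit

/-- The entries of a matrix on and above the diagonal. -/
def vech {k : ℕ} (A : Matrix (Fin k) (Fin k) ℝ) : UpperIdx k → ℝ :=
  fun p => A p.1.1 p.1.2

/-- The symmetric matrix with prescribed entries on and above the diagonal. -/
def unvech {k : ℕ} (v : UpperIdx k → ℝ) : Matrix (Fin k) (Fin k) ℝ :=
  Matrix.of fun i j => v ⟨(min i j, max i j), min_le_max⟩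

/-- The coordinate vector `(μ', (vech Σ)', ν)'` of a triple. -/
def coords {k : ℕ} (V : Triple k) : EuclideanSpace ℝ (CoordIdx k) :=
  WithLp.toLp 2 (Sum.elim (fun i => V.1 i) (Sum.elim (vech V.2.1) fun _ => V.2.2))

/-- The triple (with symmetric matrix component) that has a given coordinate vector. -/
def ofCoords {k : ℕ} (θ : EuclideanSpace ℝ (CoordIdx k)) : Triple k :=
  (WithLp.toLp 2 fun i => θ (Sum.inl i), unvech fun p => θ (Sum.inr (Sum.inl p)),
    θ (Sum.inr (Sum.inr ())))

/-- The normalizing constant `Γ((ν + k) / 2) / ((π ν)^(k / 2) Γ(ν / 2))`. -/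
def normConst (k : ℕ) (ν : ℝ) : ℝ :=
  Real.Gamma ((ν + k) / 2) / ((Real.pi * ν) ^ ((k : ℝ) / 2) * Real.Gamma (ν / 2))

/-- The squared Mahalanobis norm
`‖Σ^(-1/2) (x - μ)‖ ^ 2 = (x - μ)' Σ⁻¹ (x - μ)`. -/
def mahalanobisSq {k : ℕ} (μ : EuclideanSpace ℝ (Fin k)) (S : Matrix (Fin k) (Fin k) ℝ)
    (x : EuclideanSpace ℝ (Fin k)) : ℝ :=
  (x - μ).ofLp ⬝ᵥ (S⁻¹ *ᵥ (x - μ).ofLp)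

/-- The density of the `k`-dimensional Student `t` distribution with parameter `V = (μ, Σ, ν)`. -/
def density {k : ℕ} (V : Triple k) (x : EuclideanSpace ℝ (Fin k)) : ℝ :=
  normConst k V.2.2 * V.2.1.det ^ (-(1 / 2 : ℝ)) *
    (1 + mahalanobisSq V.1 V.2.1 x / V.2.2) ^ (-((V.2.2 + k) / 2))

/-- The `k`-dimensional Student `t` distribution. -/
def law {k : ℕ} (V : Triple k) : Measure (EuclideanSpace ℝ (Fin k)) :=
  volume.withDensity fun x => ENNReal.ofReal (density V x)

/-- The joint distribution of `n` i.i.d. Student `t` observations. -/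
def lawN {k : ℕ} (n : ℕ) (V : Triple k) : Measure (Fin n → EuclideanSpace ℝ (Fin k)) :=
  Measure.pi fun _ => law V

/-- The score vector: the gradient of the log-density with respect to `(μ, vech Σ, ν)`. -/
def score {k : ℕ} (V : Triple k) (x : EuclideanSpace ℝ (Fin k)) : EuclideanSpace ℝ (CoordIdx k) :=
  gradient (fun θ => Real.log (density (ofCoords θ) x)) (coords V)

/-- The Fisher information matrix: the covariance matrix of the score vector. -/
def fisherInfo {k : ℕ} (V : Triple k) : Matrix (CoordIdx k) (CoordIdx k) ℝ :=
  Matrix.of fun i j => cov[fun x => score V x i, fun x => score V x j; law V]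

/-- The central sequence `n^(-1/2) ∑ᵢ score V (Xᵢ)`. -/
def centralSeq {k : ℕ} (n : ℕ) (V : Triple k) (X : Fin n → EuclideanSpace ℝ (Fin k)) :
    EuclideanSpace ℝ (CoordIdx k) :=
  (√(n : ℝ))⁻¹ • ∑ i, score V (X i)

/-- `R n = o_P(1)` under the measures `P n`, on sample spaces that may depend on `n`. -/
def IsLittleOP {Ω : ℕ → Type*} [∀ n, MeasurableSpace (Ω n)] (P : ∀ n, Measure (Ω n))
    (R : ∀ n, Ω n → ℝ) : Prop :=
  ∀ ε : ℝ, 0 < ε → Tendsto (fun n => P n {ω | ε ≤ |R n ω|}) atTop (𝓝 0)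

end

end StudentT

set_option maxSynthPendingDepth 3

namespace StudentT

/-! The classical Cramér route works because the family has derivative bounds that are uniform over
all of `ℝ^k`. They come from projecting `(1, x)` centrally to the unit sphere of `ℝ × ℝ^k`. By
`log_density`, the log-density is a function of the parameter and of the projected point, minus `(ν
+ k) / 2 * log (1 + ‖x‖ ^ 2)`. The first function stays smooth across the equator, which represents
infinity. On a compact parameter ball times the compact sphere its derivatives are therefore bounded
and uniformly continuous. The subtracted term is affine in `ν`: it adds a logarithm to the score and
nothing to the Hessian. So near each parameter the score is `O(1 + log (1 + ‖x‖ ^ 2))`, the Hessian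
is bounded and equicontinuous, and one power-law envelope dominates all densities
(`exists_regularFamily`).

For such a family, a second-order Taylor expansion around `θ n` has a deterministic remainder that
tends to zero. The averaged Hessian obeys a weak law of large numbers along the moving laws
(`RegularFamily.isLittleOP_expansion`), and its limit is minus the information matrix by
`RegularFamily.integral_score_mul_score`. The central sequence is handled by a Lyapunov-type central
limit theorem with bounded third moments (`tendstoInDistribution_inv_sqrt_smul_sum`).

The information matrix is non-singular because no direction annihilates the score at every
observation (`eq_zero_of_scoreForm`). The tail component is excluded by the unbounded logarithm.
What remains says that a linear plus a quadratic form vanishes identically, so the location and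
scatter components vanish too. -/

theorem tendsto_inv_sqrt_natCast : Tendsto (fun n : ℕ => (√(n : ℝ))⁻¹) atTop (𝓝 0) :=
  tendsto_inv_atTop_zero.comp (Real.tendsto_sqrt_atTop.comp tendsto_natCast_atTop_atTop)

/-! ### Product measures: likelihood ratios and a law of large numbers for triangular arrays. -/

section ProductMeasure

variable {X : Type*} [MeasurableSpace X]

/-- A product of measures with densities has the product density. -/
theorem pi_withDensity {n : ℕ} (P : Measure X) [IsProbabilityMeasure P] {g : X → ENNReal}
    (hg : Measurable g) [IsProbabilityMeasure (P.withDensity g)] :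
    Measure.pi (fun _ : Fin n => P.withDensity g) =
      (Measure.pi fun _ : Fin n => P).withDensity fun x => ∏ i, g (x i) := by
  refine Measure.pi_eq fun s hs => ?_
  rw [withDensity_apply _ (MeasurableSet.univ_pi hs), ← lintegral_indicator (.univ_pi hs)]
  -- On a box the indicator times the product density is a product of functions of single
  -- coordinates, so independence factors its integral.
  have h1 : ∀ x : Fin n → X, (Set.univ.pi s).indicator (fun x => ∏ i, g (x i)) x =
      ∏ i, (s i).indicator g (x i) := by
    intro x
    by_cases hx : x ∈ Set.univ.pi s
    · rw [Set.indicator_of_mem hx]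
      exact Finset.prod_congr rfl fun i _ => by rw [Set.indicator_of_mem (hx i trivial)]
    · rw [Set.indicator_of_notMem hx]
      simp only [Set.mem_univ_pi, not_forall] at hx
      obtain ⟨i, hi⟩ := hx
      exact (Finset.prod_eq_zero (Finset.mem_univ i) (Set.indicator_of_notMem hi _)).symm
  simp_rw [h1]
  have hm : ∀ i, Measurable ((s i).indicator g) := fun i => hg.indicator (hs i)
  have hind : iIndepFun (fun (i : Fin n) (x : Fin n → X) => (s i).indicator g (x i))
      (Measure.pi fun _ => P) := iIndepFun_pi fun i => (hm i).aemeasurable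
  have h2 := lintegral_prod_eq_prod_lintegral_of_indepFun Finset.univ _ hind
    fun i => (hm i).comp (measurable_pi_apply i)
  rw [h2]
  refine Finset.prod_congr rfl fun i _ => ?_
  rw [withDensity_apply _ (hs i), ← lintegral_indicator (hs i)]
  exact (measurePreserving_eval (fun _ : Fin n => P) i).lintegral_comp (hm i)

/-- The log-likelihood ratio of product measures is the sum of the log-ratios. -/
theorem llr_pi_withDensity {n : ℕ} (P : Measure X) [IsProbabilityMeasure P] {u : X → ℝ}
    (hu : Measurable u)
    [IsProbabilityMeasure (P.withDensity fun x => ENNReal.ofReal (Real.exp (u x)))] :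
    llr (Measure.pi fun _ : Fin n => P.withDensity fun x => ENNReal.ofReal (Real.exp (u x)))
      (Measure.pi fun _ : Fin n => P) =ᵐ[Measure.pi fun _ : Fin n => P]
      fun x => ∑ i, u (x i) := by
  have hm : Measurable fun x => ENNReal.ofReal (Real.exp (u x)) := by fun_prop
  rw [pi_withDensity P hm]
  have h := Measure.rnDeriv_withDensity (Measure.pi fun _ : Fin n => P)
    (f := fun x => ∏ i, ENNReal.ofReal (Real.exp (u (x i)))) (by fun_prop)
  filter_upwards [h] with x hx
  rw [llr, hx, ← ENNReal.ofReal_prod_of_nonneg fun i _ => (Real.exp_pos _).le,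
    ENNReal.toReal_ofReal (Finset.prod_nonneg fun i _ => (Real.exp_pos _).le),
    ← Real.exp_sum, Real.log_exp]

/-- Weak law of large numbers for a bounded function along a sequence of laws. -/
theorem isLittleOP_average_sub (P : ℕ → Measure X) [∀ n, IsProbabilityMeasure (P n)]
    {g : X → ℝ} (hg : Measurable g) {C : ℝ} (hC : ∀ x, |g x| ≤ C) {a : ℝ}
    (ha : Tendsto (fun n => ∫ x, g x ∂P n) atTop (𝓝 a)) :
    IsLittleOP (fun n => Measure.pi fun _ : Fin n => P n)
      fun n x => (n : ℝ)⁻¹ * ∑ i, g (x i) - a := by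
  intro ε hε
  -- Half of `ε` pays for the drift of the means; Chebyshev's inequality with variance at most `C ^
  -- 2 / n` handles the other half.
  have hev : ∀ᶠ n in atTop, |∫ x, g x ∂P n - a| < ε / 2 := by
    have := (Metric.tendsto_nhds.1 ha) (ε / 2) (by positivity)
    simpa [Real.dist_eq] using this
  have hlim : Tendsto (fun n : ℕ => ENNReal.ofReal ((n : ℝ)⁻¹ * C ^ 2 / (ε / 2) ^ 2))
      atTop (𝓝 0) := by
    rw [← ENNReal.ofReal_zero]
    refine ENNReal.tendsto_ofReal ?_
    have := (tendsto_inv_atTop_nhds_zero_nat (𝕜 := ℝ)).mul_const (C ^ 2 / (ε / 2) ^ 2)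
    simpa [mul_div_assoc] using this
  refine tendsto_of_tendsto_of_tendsto_of_le_of_le' tendsto_const_nhds hlim
    (Eventually.of_forall fun _ => zero_le) ?_
  filter_upwards [hev, eventually_gt_atTop 0] with n hn hn0
  set Q := Measure.pi fun _ : Fin n => P n
  have hn0' : (0 : ℝ) < n := by exact_mod_cast hn0
  have hmem : MemLp g 2 (P n) := MemLp.of_bound hg.aestronglyMeasurable C
    (Eventually.of_forall fun x => by simpa using hC x)
  have hmp : ∀ i, MeasurePreserving (fun x : Fin n → X => x i) Q (P n) := fun i =>
    measurePreserving_eval (fun _ : Fin n => P n) i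
  have hmemi : ∀ i, MemLp (fun x : Fin n → X => g (x i)) 2 Q := fun i =>
    hmem.comp_measurePreserving (hmp i)
  have hsum : MemLp (∑ i : Fin n, fun x : Fin n → X => g (x i)) 2 Q :=
    memLp_finsetSum' _ fun i _ => hmemi i
  have hind : iIndepFun (fun (i : Fin n) (x : Fin n → X) => g (x i)) Q :=
    iIndepFun_pi fun i => hg.aemeasurable
  have hmean : ∫ x, (n : ℝ)⁻¹ * ∑ i, g (x i) ∂Q = ∫ x, g x ∂P n := by
    rw [integral_const_mul, integral_finsetSum _ fun i _ => (hmemi i).integrable one_le_two]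
    have : ∀ i, ∫ x, g (x i) ∂Q = ∫ x, g x ∂P n := fun i => by
      rw [← (hmp i).map_eq, integral_map (hmp i).measurable.aemeasurable
        hg.aestronglyMeasurable]
    simp only [this, Finset.sum_const, Finset.card_univ, Fintype.card_fin, nsmul_eq_mul]
    field_simp
  have hvar1 : variance g (P n) ≤ C ^ 2 := by
    refine (variance_le_expectation_sq hg.aestronglyMeasurable).trans ?_
    calc ∫ x, (g ^ 2) x ∂P n ≤ ∫ _, C ^ 2 ∂P n := by
          refine integral_mono_of_nonneg (Eventually.of_forall fun x => sq_nonneg _)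
            (integrable_const _) (Eventually.of_forall fun x => ?_)
          exact sq_le_sq' (neg_le_of_abs_le (hC x)) (le_of_abs_le (hC x))
      _ = C ^ 2 := by simp
  have hvar : variance (fun x : Fin n → X => (n : ℝ)⁻¹ * ∑ i, g (x i)) Q ≤
      (n : ℝ)⁻¹ * C ^ 2 := by
    rw [variance_const_mul]
    have h1 : variance (fun x : Fin n → X => ∑ i, g (x i)) Q = n * variance g (P n) := by
      have h2 := IndepFun.variance_sum (μ := Q) (s := Finset.univ)
        (X := fun (i : Fin n) (x : Fin n → X) => g (x i)) (fun i _ => hmemi i)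
        (fun i _ j _ hij => hind.indepFun hij)
      have h3 : (∑ i : Fin n, fun x : Fin n → X => g (x i)) = fun x => ∑ i, g (x i) := by
        ext x; simp
      rw [h3] at h2
      rw [h2]
      have h4 : ∀ i, variance (fun x : Fin n → X => g (x i)) Q = variance g (P n) := fun i => by
        rw [← (hmp i).map_eq, variance_map hg.aemeasurable (hmp i).measurable.aemeasurable]
        rfl
      simp [h4]
    rw [h1]
    calc ((n : ℝ)⁻¹) ^ 2 * (n * variance g (P n)) = (n : ℝ)⁻¹ * variance g (P n) := by
          field_simp
      _ ≤ _ := by gcongr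
  have hmemavg : MemLp (fun x : Fin n → X => (n : ℝ)⁻¹ * ∑ i, g (x i)) 2 Q := by
    have := hsum.const_mul (n : ℝ)⁻¹
    simpa [Finset.sum_apply] using this
  have hcheb := meas_ge_le_variance_div_sq hmemavg (half_pos hε)
  refine (measure_mono ?_).trans (hcheb.trans (ENNReal.ofReal_le_ofReal ?_))
  · intro x hx
    simp only [Set.mem_ofPred_eq] at hx ⊢
    rw [hmean]
    have := abs_sub_le ((n : ℝ)⁻¹ * ∑ i, g (x i)) (∫ x, g x ∂P n) a
    linarith
  · gcongr

end ProductMeasure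

/-! ### Calculus of `o_P(1)`. -/

section IsLittleOP

variable {Ω : ℕ → Type*} [∀ n, MeasurableSpace (Ω n)] {P : ∀ n, Measure (Ω n)}

theorem IsLittleOP.add {R S : ∀ n, Ω n → ℝ} (hR : IsLittleOP P R) (hS : IsLittleOP P S) :
    IsLittleOP P fun n ω => R n ω + S n ω := by
  intro ε hε
  have h := (hR (ε / 2) (half_pos hε)).add (hS (ε / 2) (half_pos hε))
  rw [add_zero] at h
  refine tendsto_of_tendsto_of_tendsto_of_le_of_le tendsto_const_nhds h
    (fun _ => zero_le) fun n => (measure_mono ?_).trans (measure_union_le _ _)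
  intro ω hω
  simp only [Set.mem_ofPred_eq, Set.mem_union] at hω ⊢
  by_contra! hcon
  linarith [abs_add_le (R n ω) (S n ω), hcon.1, hcon.2]

/-- The comparison is almost sure because log-likelihood ratios are determined only up to null sets.
-/
theorem IsLittleOP.of_abs_le {R S : ∀ n, Ω n → ℝ} (hS : IsLittleOP P S)
    (h : ∀ᶠ n in atTop, ∀ᵐ ω ∂P n, |R n ω| ≤ |S n ω|) : IsLittleOP P R := by
  intro ε hε
  refine tendsto_of_tendsto_of_tendsto_of_le_of_le' tendsto_const_nhds (hS ε hε)
    (Eventually.of_forall fun _ => zero_le) ?_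
  filter_upwards [h] with n hn
  refine measure_mono_ae ?_
  filter_upwards [hn] with ω hω hε' using le_trans hε' hω

theorem IsLittleOP.const_mul {S : ∀ n, Ω n → ℝ} (hS : IsLittleOP P S) (c : ℝ) :
    IsLittleOP P fun n ω => c * S n ω := by
  intro ε hε
  -- The summand `1` in the denominator covers `c = 0`.
  refine tendsto_of_tendsto_of_tendsto_of_le_of_le tendsto_const_nhds
    (hS (ε / (|c| + 1)) (by positivity)) (fun _ => zero_le) fun n => measure_mono ?_
  intro ω hω
  simp only [Set.mem_ofPred_eq] at hω ⊢
  rw [abs_mul] at hω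
  rw [div_le_iff₀ (by positivity)]
  nlinarith [abs_nonneg (S n ω), abs_nonneg c]

theorem IsLittleOP.abs {S : ∀ n, Ω n → ℝ} (hS : IsLittleOP P S) :
    IsLittleOP P fun n ω => |S n ω| :=
  hS.of_abs_le (Eventually.of_forall fun n => Eventually.of_forall fun ω => by simp)

theorem IsLittleOP.sum {ι : Type*} (s : Finset ι) {S : ι → ∀ n, Ω n → ℝ}
    (hS : ∀ i ∈ s, IsLittleOP P (S i)) : IsLittleOP P fun n ω => ∑ i ∈ s, S i n ω := by
  classical
  induction s using Finset.induction_on with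
  | empty =>
    intro ε hε
    simp [not_le.2 hε]
  | insert a s ha ih =>
    simp only [Finset.sum_insert ha]
    exact (hS a (Finset.mem_insert_self _ _)).add
      (ih fun i hi => hS i (Finset.mem_insert_of_mem hi))

end IsLittleOP

/-! ### Central limit theorem via characteristic functions. -/

section CentralLimit

open Complex

/-- Mean value inequality: between `0` and `u` the derivative has norm at most `|u|`. The sharp
factor `1 / 2` is not needed. -/
theorem norm_exp_I_mul_sub_one_sub_le (u : ℝ) : ‖exp (I * u) - 1 - I * u‖ ≤ |u| ^ 2 := by
  have hd : ∀ v : ℝ, HasDerivAt (fun v : ℝ => exp (I * v) - 1 - I * v)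
      (I * (exp (I * v) - 1)) v := fun v => by
    have h1 : HasDerivAt (fun v : ℝ => I * (v : ℂ)) I v := by
      simpa using (Complex.ofRealCLM.hasDerivAt (x := v)).const_mul I
    convert! ((h1.cexp).sub_const 1).sub h1 using 1
    ring
  have := (convex_uIcc (0 : ℝ) u).norm_image_sub_le_of_norm_hasDerivWithin_le (C := |u|)
    (fun v _ => (hd v).hasDerivWithinAt) (fun v hv => ?_) Set.left_mem_uIcc Set.right_mem_uIcc
  · simpa [sq] using this
  · rw [norm_mul, Complex.norm_I, one_mul]
    have h1 := Real.norm_exp_I_mul_ofReal_sub_one_le (x := v)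
    have h2 := Set.abs_sub_left_of_mem_uIcc hv
    simp only [sub_zero] at h2
    exact h1.trans h2

theorem norm_exp_I_mul_sub_taylor_two_le (u : ℝ) :
    ‖exp (I * u) - 1 - I * u + u ^ 2 / 2‖ ≤ |u| ^ 3 := by
  have hd : ∀ v : ℝ, HasDerivAt (fun v : ℝ => exp (I * v) - 1 - I * v + v ^ 2 / 2)
      (I * (exp (I * v) - 1 - I * v)) v := fun v => by
    have h0 : HasDerivAt (fun v : ℝ => (v : ℂ)) 1 v := Complex.ofRealCLM.hasDerivAt (x := v)
    have h1 : HasDerivAt (fun v : ℝ => I * (v : ℂ)) I v := by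
      simpa using h0.const_mul I
    convert! (((h1.cexp).sub_const 1).sub h1).add ((h0.pow 2).div_const 2) using 1
    linear_combination (-(v : ℂ)) * I_mul_I
  have := (convex_uIcc (0 : ℝ) u).norm_image_sub_le_of_norm_hasDerivWithin_le (C := |u| ^ 2)
    (fun v _ => (hd v).hasDerivWithinAt) (fun v hv => ?_) Set.left_mem_uIcc Set.right_mem_uIcc
  · simpa [pow_succ] using this
  · rw [norm_mul, Complex.norm_I, one_mul]
    have h1 := norm_exp_I_mul_sub_one_sub_le v
    have h2 := Set.abs_sub_left_of_mem_uIcc hv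
    simp only [sub_zero] at h2
    exact h1.trans (by gcongr)

variable {X : Type*} [MeasurableSpace X] {ι : Type*} [Fintype ι]

theorem measurable_smul_sum {n : ℕ} {s : X → EuclideanSpace ℝ ι} (hs : Measurable s) (c : ℝ) :
    Measurable fun x : Fin n → X => c • ∑ i, s (x i) :=
  (Finset.measurable_fun_sum _ fun i _ => hs.comp (measurable_pi_apply i)).const_smul c

theorem charFun_map_inv_sqrt_smul_sum (P : Measure X) [IsProbabilityMeasure P]
    {s : X → EuclideanSpace ℝ ι} (hs : Measurable s) (n : ℕ) (t : EuclideanSpace ℝ ι) :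
    charFun ((Measure.pi fun _ : Fin n => P).map fun x => (√(n : ℝ))⁻¹ • ∑ i, s (x i)) t =
      (∫ x, exp (I * (((√(n : ℝ))⁻¹ * inner ℝ (s x) t : ℝ) : ℂ)) ∂P) ^ n := by
  rw [charFun_apply, integral_map (measurable_smul_sum hs _).aemeasurable (by fun_prop)]
  have := integral_fintype_prod_eq_pow (ι := Fin n) (μ := P)
    (fun x => exp (I * (((√(n : ℝ))⁻¹ * inner ℝ (s x) t : ℝ) : ℂ)))
  rw [Fintype.card_fin] at this
  rw [← this]
  congr 1
  ext x
  rw [← Complex.exp_sum, real_inner_smul_left, sum_inner, mul_comm]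
  push_cast
  rw [Finset.mul_sum, Finset.mul_sum]

/-- Central limit theorem for the rows of a triangular array that are i.i.d., centred, with
convergent covariances and bounded third moments. -/
theorem tendstoInDistribution_inv_sqrt_smul_sum [DecidableEq ι] (P : ℕ → Measure X)
    [∀ n, IsProbabilityMeasure (P n)] {s : ℕ → X → EuclideanSpace ℝ ι}
    (hs : ∀ n, Measurable (s n)) {Γ : Matrix ι ι ℝ} (hΓ : Γ.PosSemidef) {C : ℝ}
    (h3 : ∀ᶠ n in atTop, Integrable (fun x => ‖s n x‖ ^ 3) (P n) ∧ ∫ x, ‖s n x‖ ^ 3 ∂P n ≤ C)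
    (hmean : ∀ᶠ n in atTop, ∀ t, ∫ x, inner ℝ (s n x) t ∂P n = 0)
    (hcov : ∀ t : EuclideanSpace ℝ ι, Tendsto (fun n => ∫ x, (inner ℝ (s n x) t) ^ 2 ∂P n) atTop
      (𝓝 (t.ofLp ⬝ᵥ (Γ *ᵥ t.ofLp)))) :
    TendstoInDistribution
      (fun n (x : Fin n → X) => (√(n : ℝ))⁻¹ • ∑ i, s n (x i)) atTop id
      (fun n => Measure.pi fun _ : Fin n => P n) (multivariateGaussian 0 Γ) where
  forall_aemeasurable n := (measurable_smul_sum (hs n) _).aemeasurable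
  aemeasurable_limit := by fun_prop
  tendsto := by
    refine ProbabilityMeasure.tendsto_iff_tendsto_charFun.2 fun t => ?_
    simp only [ProbabilityMeasure.coe_mk, Measure.map_id, charFun_multivariateGaussian hΓ,
      inner_zero_right, charFun_map_inv_sqrt_smul_sum _ (hs _)]
    -- The characteristic function is `(1 + z n / n) ^ n`, where `z n` is the quantity shown here,
    -- so the limit of `z n` is the limiting exponent.
    have key : Tendsto (fun n : ℕ => (n : ℂ) *
        (∫ x, exp (I * (((√(n : ℝ))⁻¹ * inner ℝ (s n x) t : ℝ) : ℂ)) ∂P n - 1)) atTop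
        (𝓝 (-(((t.ofLp ⬝ᵥ (Γ *ᵥ t.ofLp) : ℝ) : ℂ) / 2))) := by
      have h1 : Tendsto (fun n : ℕ => -((∫ x, (inner ℝ (s n x) t) ^ 2 ∂P n : ℝ) : ℂ) / 2) atTop
          (𝓝 (-(((t.ofLp ⬝ᵥ (Γ *ᵥ t.ofLp) : ℝ) : ℂ) / 2))) := by
        have := ((Complex.continuous_ofReal.tendsto _).comp (hcov t)).neg.div_const 2
        simpa [neg_div, Function.comp_def] using this
      refine tendsto_of_tendsto_of_dist h1 ?_
      -- The cubic Taylor remainder contributes `n * n ^ (-3/2)` times a bounded third moment.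
      have h2 : Tendsto (fun n : ℕ => (√(n : ℝ))⁻¹ * (‖t‖ ^ 3 * C)) atTop (𝓝 0) := by
        simpa using tendsto_inv_sqrt_natCast.mul_const (‖t‖ ^ 3 * C)
      refine squeeze_zero' (Eventually.of_forall fun _ => dist_nonneg) ?_ h2
      filter_upwards [h3, hmean, eventually_gt_atTop 0] with n hn3 hn0 hn
      have hn' : (0 : ℝ) < n := by exact_mod_cast hn
      have hsq : (√(n : ℝ)) ^ 2 = n := Real.sq_sqrt hn'.le
      have hsp : 0 < √(n : ℝ) := Real.sqrt_pos.2 hn'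
      have hmeas : Measurable fun x => inner ℝ (s n x) t := by fun_prop
      have hL3 : MemLp (s n) 3 (P n) := by
        have := (integrable_norm_rpow_iff (hs n).aestronglyMeasurable (p := 3)
          (by norm_num) (by norm_num)).1 (by simpa using hn3.1)
        exact this
      have hL3' : MemLp (fun x => inner ℝ (s n x) t) 3 (P n) := hL3.inner_const t
      have hi1 : Integrable (fun x => inner ℝ (s n x) t) (P n) :=
        hL3'.integrable (by norm_num)
      have hi2 : Integrable (fun x => (inner ℝ (s n x) t) ^ 2) (P n) :=
        (hL3'.mono_exponent (by norm_num)).integrable_sq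
      have hie : Integrable
          (fun x => exp (I * (((√(n : ℝ))⁻¹ * inner ℝ (s n x) t : ℝ) : ℂ))) (P n) := by
        refine Integrable.of_bound (by fun_prop) 1 (Eventually.of_forall fun x => ?_)
        rw [Complex.norm_exp_I_mul_ofReal]
      have hexp : (n : ℂ) *
          (∫ x, exp (I * (((√(n : ℝ))⁻¹ * inner ℝ (s n x) t : ℝ) : ℂ)) ∂P n - 1) -
          -((∫ x, (inner ℝ (s n x) t) ^ 2 ∂P n : ℝ) : ℂ) / 2 =
          n * ∫ x, (exp (I * (((√(n : ℝ))⁻¹ * inner ℝ (s n x) t : ℝ) : ℂ)) - 1 -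
            I * (((√(n : ℝ))⁻¹ * inner ℝ (s n x) t : ℝ) : ℂ) +
            ((((√(n : ℝ))⁻¹ * inner ℝ (s n x) t : ℝ) : ℂ)) ^ 2 / 2) ∂P n := by
        have e1 : ∫ x, I * (((√(n : ℝ))⁻¹ * inner ℝ (s n x) t : ℝ) : ℂ) ∂P n = 0 := by
          rw [integral_const_mul, integral_complex_ofReal, integral_const_mul, hn0]
          simp
        have e2 : ∫ x, ((((√(n : ℝ))⁻¹ * inner ℝ (s n x) t : ℝ) : ℂ)) ^ 2 / 2 ∂P n =
            (n : ℂ)⁻¹ * ((∫ x, (inner ℝ (s n x) t) ^ 2 ∂P n : ℝ) : ℂ) / 2 := by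
          rw [integral_div]
          simp_rw [← Complex.ofReal_pow, mul_pow, inv_pow, hsq]
          rw [integral_complex_ofReal, integral_const_mul]
          push_cast
          rfl
        have j1 : Integrable (fun x => I * (((√(n : ℝ))⁻¹ * inner ℝ (s n x) t : ℝ) : ℂ)) (P n) :=
          ((hi1.const_mul _).ofReal).const_mul I
        have j2 : Integrable
            (fun x => ((((√(n : ℝ))⁻¹ * inner ℝ (s n x) t : ℝ) : ℂ)) ^ 2 / 2) (P n) := by
          simp_rw [← Complex.ofReal_pow, mul_pow]
          exact ((hi2.const_mul _).ofReal).div_const 2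
        have j0 : Integrable
            (fun x => exp (I * (((√(n : ℝ))⁻¹ * inner ℝ (s n x) t : ℝ) : ℂ)) - 1) (P n) :=
          hie.sub (integrable_const _)
        have j01 : Integrable
            (fun x => exp (I * (((√(n : ℝ))⁻¹ * inner ℝ (s n x) t : ℝ) : ℂ)) - 1 -
              I * (((√(n : ℝ))⁻¹ * inner ℝ (s n x) t : ℝ) : ℂ)) (P n) := j0.sub j1
        rw [integral_add j01 j2, integral_sub j0 j1, integral_sub hie (integrable_const _),
          e1, e2]
        have : (n : ℂ) ≠ 0 := by exact_mod_cast hn.ne'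
        simp only [integral_const, probReal_univ, one_smul]
        generalize ∫ x, exp (I * (((√(n : ℝ))⁻¹ * inner ℝ (s n x) t : ℝ) : ℂ)) ∂P n = z
        field_simp
        ring
      rw [dist_comm, dist_eq_norm, hexp, norm_mul]
      have hb : ‖∫ x, (exp (I * (((√(n : ℝ))⁻¹ * inner ℝ (s n x) t : ℝ) : ℂ)) - 1 -
            I * (((√(n : ℝ))⁻¹ * inner ℝ (s n x) t : ℝ) : ℂ) +
            ((((√(n : ℝ))⁻¹ * inner ℝ (s n x) t : ℝ) : ℂ)) ^ 2 / 2) ∂P n‖ ≤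
          ∫ x, ((√(n : ℝ))⁻¹) ^ 3 * ‖t‖ ^ 3 * ‖s n x‖ ^ 3 ∂P n := by
        refine norm_integral_le_of_norm_le (hn3.1.const_mul _) (Eventually.of_forall fun x => ?_)
        refine (norm_exp_I_mul_sub_taylor_two_le _).trans ?_
        rw [abs_mul, abs_of_pos (inv_pos.2 hsp)]
        calc ((√(n : ℝ))⁻¹ * |inner ℝ (s n x) t|) ^ 3
            ≤ ((√(n : ℝ))⁻¹ * (‖s n x‖ * ‖t‖)) ^ 3 := by
              gcongr
              exact abs_real_inner_le_norm _ _
          _ = _ := by ring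
      rw [integral_const_mul] at hb
      have hnn : ‖(n : ℂ)‖ = (√(n : ℝ)) ^ 2 := by rw [hsq]; simp
      rw [hnn]
      calc (√(n : ℝ)) ^ 2 * _ ≤ (√(n : ℝ)) ^ 2 *
            (((√(n : ℝ))⁻¹) ^ 3 * ‖t‖ ^ 3 * ∫ x, ‖s n x‖ ^ 3 ∂P n) := by gcongr
        _ ≤ (√(n : ℝ)) ^ 2 * (((√(n : ℝ))⁻¹) ^ 3 * ‖t‖ ^ 3 * C) := by
            gcongr
            exact hn3.2
        _ = _ := by field_simp
    have := Complex.tendsto_one_add_pow_exp_of_tendsto key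
    simpa using this

end CentralLimit

/-! ### Taylor expansion with a frozen Hessian. -/

section Taylor

variable {E : Type*} [NormedAddCommGroup E] [NormedSpace ℝ E]

/-- Second-order Taylor expansion with a nearly constant Hessian. -/
theorem abs_taylor_two_sub_le {s : Set E} (hs : Convex ℝ s) {f : E → ℝ} {D₁ : E → E →L[ℝ] ℝ}
    {D₂ : E → E →L[ℝ] E →L[ℝ] ℝ} (h₁ : ∀ θ ∈ s, HasFDerivAt f (D₁ θ) θ)
    (h₂ : ∀ θ ∈ s, HasFDerivAt D₁ (D₂ θ) θ) (A : E →L[ℝ] E →L[ℝ] ℝ) {ω : ℝ}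
    (hω : ∀ θ ∈ s, ‖D₂ θ - A‖ ≤ ω) {θ η : E} (hθ : θ ∈ s) (hη : θ + η ∈ s) :
    |f (θ + η) - f θ - D₁ θ η - 1 / 2 * A η η| ≤ ω * ‖η‖ ^ 2 := by
  have hmem : ∀ t ∈ Set.Icc (0 : ℝ) 1, θ + t • η ∈ s := fun t ht => by
    have := hs.add_smul_sub_mem hθ hη ht
    simpa using this
  have hline : ∀ t : ℝ, HasDerivAt (fun t : ℝ => θ + t • η) η t := fun t => by
    simpa using ((hasDerivAt_id t).smul_const η).const_add θ
  have hω0 : 0 ≤ ω := (norm_nonneg _).trans (hω θ hθ)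
  -- The mean value inequality is applied twice along the segment, after subtracting the polynomial
  -- with Hessian `A`: first to the derivative, then to the function.
  have d₂ : ∀ t ∈ Set.Icc (0 : ℝ) 1,
      HasDerivAt (fun t : ℝ => D₁ (θ + t • η) η - D₁ θ η - t * A η η)
        ((D₂ (θ + t • η) - A) η η) t := fun t ht => by
    have h : HasDerivAt (fun t : ℝ => D₁ (θ + t • η)) (D₂ (θ + t • η) η) t :=
      (h₂ _ (hmem t ht)).comp_hasDerivAt t (hline t)
    have h' : HasDerivAt (fun t : ℝ => D₁ (θ + t • η) η) (D₂ (θ + t • η) η η) t :=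
      (ContinuousLinearMap.apply ℝ ℝ η).hasFDerivAt.comp_hasDerivAt t h
    have h'' : HasDerivAt (fun t : ℝ => t * A η η) (A η η) t := by
      simpa using (hasDerivAt_id t).mul_const (A η η)
    exact (h'.sub_const (D₁ θ η)).sub h''
  have b₂ : ∀ t ∈ Set.Icc (0 : ℝ) 1,
      ‖D₁ (θ + t • η) η - D₁ θ η - t * A η η‖ ≤ ω * ‖η‖ ^ 2 := fun t ht => by
    have := (convex_Icc (0 : ℝ) 1).norm_image_sub_le_of_norm_hasDerivWithin_le
      (C := ω * ‖η‖ ^ 2) (fun t ht => (d₂ t ht).hasDerivWithinAt) (fun t ht => ?_)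
      (Set.left_mem_Icc.2 zero_le_one) ht
    · simp only [zero_smul, add_zero, zero_mul, sub_zero, sub_self] at this
      refine this.trans (mul_le_of_le_one_right (by positivity) ?_)
      rw [Real.norm_eq_abs, abs_of_nonneg ht.1]
      exact ht.2
    · calc ‖(D₂ (θ + t • η) - A) η η‖ ≤ ‖D₂ (θ + t • η) - A‖ * ‖η‖ * ‖η‖ :=
            ContinuousLinearMap.le_opNorm₂ _ _ _
        _ ≤ ω * ‖η‖ * ‖η‖ := by gcongr; exact hω _ (hmem t ht)
        _ = _ := by ring
  have d₁ : ∀ t ∈ Set.Icc (0 : ℝ) 1,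
      HasDerivAt (fun t : ℝ => f (θ + t • η) - t * D₁ θ η - 1 / 2 * t ^ 2 * A η η)
        (D₁ (θ + t • η) η - D₁ θ η - t * A η η) t := fun t ht => by
    have h : HasDerivAt (fun t : ℝ => f (θ + t • η)) (D₁ (θ + t • η) η) t :=
      (h₁ _ (hmem t ht)).comp_hasDerivAt t (hline t)
    have h'' : HasDerivAt (fun t : ℝ => t * D₁ θ η) (D₁ θ η) t := by
      simpa using (hasDerivAt_id t).mul_const (D₁ θ η)
    have h' : HasDerivAt (fun t : ℝ => 1 / 2 * t ^ 2 * A η η) (t * A η η) t := by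
      convert! (((hasDerivAt_id t).pow 2).const_mul (1 / 2 : ℝ)).mul_const (A η η) using 1
      simp
    exact (h.sub h'').sub h'
  have := (convex_Icc (0 : ℝ) 1).norm_image_sub_le_of_norm_hasDerivWithin_le
    (fun t ht => (d₁ t ht).hasDerivWithinAt) b₂
    (Set.left_mem_Icc.2 zero_le_one) (Set.right_mem_Icc.2 zero_le_one)
  rw [← Real.norm_eq_abs]
  convert! this using 1
  · congr 1
    simp
    ring
  · simp

end Taylor

/-! ### Dominated families of log-densities and the information identity. -/

section Regular

variable {E X : Type*} [NormedAddCommGroup E] [NormedSpace ℝ E]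
  [MeasurableSpace X]

/-- A family of log-densities `ℓ θ`, for `θ` in a ball around `θ₀`, with first derivative `S₁` and
second derivative `S₂`: the densities are dominated by `w`, the first derivative by `b`, where
`b ^ 3 * w` is integrable, and the second derivative is bounded and equicontinuous at `θ₀`. -/
structure RegularFamily (vol : Measure X) (ℓ : E → X → ℝ) (S₁ : E → X → E →L[ℝ] ℝ)
    (S₂ : E → X → E →L[ℝ] E →L[ℝ] ℝ) (b w : X → ℝ) (θ₀ : E) (r C : ℝ) : Prop where
  pos : 0 < r
  hasFDerivAt : ∀ θ ∈ Metric.ball θ₀ r, ∀ x, HasFDerivAt (fun θ => ℓ θ x) (S₁ θ x) θ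
  hasFDerivAt' : ∀ θ ∈ Metric.ball θ₀ r, ∀ x, HasFDerivAt (fun θ => S₁ θ x) (S₂ θ x) θ
  measurable : ∀ θ ∈ Metric.ball θ₀ r, Measurable (ℓ θ)
  measurable₁ : ∀ θ ∈ Metric.ball θ₀ r, StronglyMeasurable (S₁ θ)
  measurable₂ : ∀ θ ∈ Metric.ball θ₀ r, StronglyMeasurable (S₂ θ)
  measurable_b : Measurable b
  measurable_w : Measurable w
  exp_le : ∀ θ ∈ Metric.ball θ₀ r, ∀ x, Real.exp (ℓ θ x) ≤ w x
  norm_le₁ : ∀ θ ∈ Metric.ball θ₀ r, ∀ x, ‖S₁ θ x‖ ≤ b x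
  norm_le₂ : ∀ θ ∈ Metric.ball θ₀ r, ∀ x, ‖S₂ θ x‖ ≤ C
  one_le : ∀ x, 1 ≤ b x
  integrable : Integrable (fun x => b x ^ 3 * w x) vol
  equicontinuous : ∀ ε > 0, ∀ᶠ θ in 𝓝 θ₀, ∀ x, ‖S₂ θ x - S₂ θ₀ x‖ ≤ ε
  integral_eq_one : ∀ θ ∈ Metric.ball θ₀ r, ∫ x, Real.exp (ℓ θ x) ∂vol = 1

theorem integral_withDensity_exp {F : Type*} [NormedAddCommGroup F] [NormedSpace ℝ F]
    (vol : Measure X) {u : X → ℝ} (hu : Measurable u) (g : X → F) :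
    ∫ x, g x ∂(vol.withDensity fun x => ENNReal.ofReal (Real.exp (u x))) =
      ∫ x, Real.exp (u x) • g x ∂vol := by
  rw [integral_withDensity_eq_integral_toReal_smul (by fun_prop)
    (Eventually.of_forall fun x => ENNReal.ofReal_lt_top)]
  simp [ENNReal.toReal_ofReal (Real.exp_pos _).le]

theorem integrable_withDensity_exp_iff {F : Type*} [NormedAddCommGroup F] [NormedSpace ℝ F]
    (vol : Measure X) {u : X → ℝ} (hu : Measurable u) (g : X → F) :
    Integrable g (vol.withDensity fun x => ENNReal.ofReal (Real.exp (u x))) ↔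
      Integrable (fun x => Real.exp (u x) • g x) vol := by
  rw [integrable_withDensity_iff_integrable_smul' (by fun_prop)
    (Eventually.of_forall fun x => ENNReal.ofReal_lt_top)]
  simp [ENNReal.toReal_ofReal (Real.exp_pos _).le]

namespace RegularFamily

variable {vol : Measure X} {ℓ : E → X → ℝ} {S₁ : E → X → E →L[ℝ] ℝ}
  {S₂ : E → X → E →L[ℝ] E →L[ℝ] ℝ} {b w : X → ℝ} {θ₀ : E} {r C : ℝ}

theorem w_nonneg (h : RegularFamily vol ℓ S₁ S₂ b w θ₀ r C) (x : X) : 0 ≤ w x :=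
  (Real.exp_pos _).le.trans (h.exp_le θ₀ (Metric.mem_ball_self h.pos) x)

theorem integrable_pow (h : RegularFamily vol ℓ S₁ S₂ b w θ₀ r C) {j : ℕ} (hj : j ≤ 3) :
    Integrable (fun x => b x ^ j * w x) vol := by
  refine h.integrable.mono' ((h.measurable_b.pow_const j).mul h.measurable_w).aestronglyMeasurable
    (Eventually.of_forall fun x => ?_)
  have hw := h.w_nonneg x
  have hb : 0 ≤ b x := zero_le_one.trans (h.one_le x)
  rw [Real.norm_of_nonneg (by positivity)]
  have := h.one_le x
  gcongr

/-- A single envelope `b ^ 3 * w` covers every moment that occurs, since `1 ≤ b` makes lower powers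
smaller. -/
theorem integrable_of_norm_le (h : RegularFamily vol ℓ S₁ S₂ b w θ₀ r C) {F : Type*}
    [NormedAddCommGroup F] [NormedSpace ℝ F] {θ : E} (hθ : θ ∈ Metric.ball θ₀ r) {g : X → F}
    (hg : AEStronglyMeasurable g vol) {K : ℝ} {j : ℕ} (hj : j ≤ 3)
    (hb : ∀ x, ‖g x‖ ≤ K * b x ^ j) : Integrable (fun x => Real.exp (ℓ θ x) • g x) vol := by
  refine ((h.integrable_pow hj).const_mul K).mono'
    (((h.measurable θ hθ).exp.aestronglyMeasurable).smul hg) (Eventually.of_forall fun x => ?_)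
  rw [norm_smul, Real.norm_of_nonneg (Real.exp_pos _).le]
  calc Real.exp (ℓ θ x) * ‖g x‖ ≤ w x * (K * b x ^ j) :=
        mul_le_mul (h.exp_le θ hθ x) (hb x) (norm_nonneg _) (h.w_nonneg x)
    _ = _ := by ring

/-- The first derivative of the log-density is centred. -/
theorem integral_score (h : RegularFamily vol ℓ S₁ S₂ b w θ₀ r C) {θ : E}
    (hθ : θ ∈ Metric.ball θ₀ r) : ∫ x, Real.exp (ℓ θ x) • S₁ θ x ∂vol = 0 := by
  have hball := Metric.isOpen_ball.mem_nhds hθ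
  have h1 := hasFDerivAt_integral_of_dominated_of_fderiv_le (μ := vol) (x₀ := θ)
    (F := fun θ x => Real.exp (ℓ θ x)) (F' := fun θ x => Real.exp (ℓ θ x) • S₁ θ x)
    (bound := fun x => b x ^ 1 * w x) hball
    (by filter_upwards [hball] with θ' hθ'
        exact (h.measurable θ' hθ').exp.aestronglyMeasurable)
    (by simpa using h.integrable_of_norm_le hθ (g := fun _ => (1 : ℝ)) (K := 1) (j := 0)
          aestronglyMeasurable_const (by norm_num) (by simp))
    ((h.measurable θ hθ).exp.aestronglyMeasurable.smul (h.measurable₁ θ hθ).aestronglyMeasurable)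
    (Eventually.of_forall fun x θ' hθ' => by
      rw [norm_smul, Real.norm_of_nonneg (Real.exp_pos _).le, mul_comm, pow_one]
      exact mul_le_mul (h.norm_le₁ θ' hθ' x) (h.exp_le θ' hθ' x) (Real.exp_pos _).le
        (zero_le_one.trans (h.one_le x)))
    (h.integrable_pow (by norm_num))
    (Eventually.of_forall fun x θ' hθ' => (h.hasFDerivAt θ' hθ' x).exp)
  -- The total mass is constantly one near `θ`, so its derivative is zero.
  have h2 : HasFDerivAt (fun θ => ∫ x, Real.exp (ℓ θ x) ∂vol) (0 : E →L[ℝ] ℝ) θ := by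
    refine (hasFDerivAt_const (1 : ℝ) θ).congr_of_eventuallyEq ?_
    filter_upwards [hball] with θ' hθ' using h.integral_eq_one θ' hθ'
  exact h1.unique h2

/-- The information identity: the second moments of the first derivative of the log-density are
minus the mean of the second derivative. -/
theorem integral_score_mul_score (h : RegularFamily vol ℓ S₁ S₂ b w θ₀ r C) (u v : E) :
    ∫ x, Real.exp (ℓ θ₀ x) * (S₁ θ₀ x u * S₁ θ₀ x v) ∂vol =
      -∫ x, Real.exp (ℓ θ₀ x) * S₂ θ₀ x u v ∂vol := by
  have hθ := Metric.mem_ball_self h.pos (x := θ₀)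
  have hball := Metric.ball_mem_nhds θ₀ h.pos
  have hm₁ := (h.measurable₁ θ₀ hθ).aestronglyMeasurable (μ := vol)
  have hm₂ := (h.measurable₂ θ₀ hθ).aestronglyMeasurable (μ := vol)
  have hme := (h.measurable θ₀ hθ).exp.aestronglyMeasurable (μ := vol)
  have hb0 : ∀ x, 0 ≤ b x := fun x => zero_le_one.trans (h.one_le x)
  have hmF : AEStronglyMeasurable (fun x => Real.exp (ℓ θ₀ x) • S₂ θ₀ x +
      (Real.exp (ℓ θ₀ x) • S₁ θ₀ x).smulRight (S₁ θ₀ x)) vol := by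
    refine (hme.smul hm₂).add ?_
    have hc : Continuous fun p : (E →L[ℝ] ℝ) × (E →L[ℝ] ℝ) => p.1.smulRight p.2 :=
      (ContinuousLinearMap.smulRightL ℝ E (E →L[ℝ] ℝ)).continuous₂
    exact hc.comp_aestronglyMeasurable ((hme.smul hm₁).prodMk hm₁)
  -- Differentiating the density times the score produces the Hessian, bounded by `C`, and the
  -- square of the score, bounded by `b ^ 2`.
  have h1 := hasFDerivAt_integral_of_dominated_of_fderiv_le (μ := vol) (x₀ := θ₀)
    (F := fun θ x => Real.exp (ℓ θ x) • S₁ θ x)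
    (F' := fun θ x => Real.exp (ℓ θ x) • S₂ θ x +
      (Real.exp (ℓ θ x) • S₁ θ x).smulRight (S₁ θ x))
    (bound := fun x => C * (b x ^ 0 * w x) + b x ^ 2 * w x) hball
    (by filter_upwards [hball] with θ' hθ'
        exact (h.measurable θ' hθ').exp.aestronglyMeasurable.smul
          (h.measurable₁ θ' hθ').aestronglyMeasurable)
    (h.integrable_of_norm_le hθ hm₁ (K := 1) (j := 1) (by norm_num)
      (by simpa using h.norm_le₁ θ₀ hθ))
    hmF
    (Eventually.of_forall fun x θ' hθ' => by
      have e1 := h.exp_le θ' hθ' x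
      have e2 := h.norm_le₁ θ' hθ' x
      have e3 := h.norm_le₂ θ' hθ' x
      have e4 := h.w_nonneg x
      have e5 := hb0 x
      refine (norm_add_le _ _).trans (add_le_add ?_ ?_)
      · rw [norm_smul, Real.norm_of_nonneg (Real.exp_pos _).le, mul_comm, pow_zero, one_mul]
        exact mul_le_mul e3 e1 (Real.exp_pos _).le ((norm_nonneg _).trans e3)
      · rw [ContinuousLinearMap.norm_smulRight_apply, norm_smul,
          Real.norm_of_nonneg (Real.exp_pos _).le]
        calc Real.exp (ℓ θ' x) * ‖S₁ θ' x‖ * ‖S₁ θ' x‖ ≤ w x * b x * b x := by gcongr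
          _ = _ := by ring)
    (((h.integrable_pow (by norm_num)).const_mul C).add (h.integrable_pow (by norm_num)))
    (Eventually.of_forall fun x θ' hθ' =>
      ((h.hasFDerivAt θ' hθ' x).exp).smul (h.hasFDerivAt' θ' hθ' x))
  -- The score is centred at all nearby parameters, so this integral has zero derivative.
  have h2 : HasFDerivAt (fun θ => ∫ x, Real.exp (ℓ θ x) • S₁ θ x ∂vol)
      (0 : E →L[ℝ] E →L[ℝ] ℝ) θ₀ := by
    refine (hasFDerivAt_const (0 : E →L[ℝ] ℝ) θ₀).congr_of_eventuallyEq ?_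
    filter_upwards [hball] with θ' hθ' using h.integral_score hθ'
  have h3 := congrArg (fun L : E →L[ℝ] E →L[ℝ] ℝ => L u v) (h1.unique h2)
  have hi1 : Integrable (fun x => Real.exp (ℓ θ₀ x) • S₂ θ₀ x) vol :=
    h.integrable_of_norm_le hθ hm₂ (K := C) (j := 0) (by norm_num)
      (by simpa using h.norm_le₂ θ₀ hθ)
  have hi2 : Integrable (fun x => (Real.exp (ℓ θ₀ x) • S₁ θ₀ x).smulRight (S₁ θ₀ x)) vol := by
    have hc : Continuous fun p : (E →L[ℝ] ℝ) × (E →L[ℝ] ℝ) => p.1.smulRight p.2 :=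
      (ContinuousLinearMap.smulRightL ℝ E (E →L[ℝ] ℝ)).continuous₂
    have := h.integrable_of_norm_le hθ (g := fun x => (S₁ θ₀ x).smulRight (S₁ θ₀ x))
      (hc.comp_aestronglyMeasurable (hm₁.prodMk hm₁)) (K := 1) (j := 2) (by norm_num)
      (fun x => by
        rw [ContinuousLinearMap.norm_smulRight_apply, one_mul, sq]
        have e2 := h.norm_le₁ θ₀ hθ x
        have e5 := hb0 x
        gcongr)
    refine this.congr (Eventually.of_forall fun x => ?_)
    ext; simp [mul_assoc]
  have hi : Integrable (fun x => Real.exp (ℓ θ₀ x) • S₂ θ₀ x +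
      (Real.exp (ℓ θ₀ x) • S₁ θ₀ x).smulRight (S₁ θ₀ x)) vol := hi1.add hi2
  simp only [zero_apply] at h3
  rw [ContinuousLinearMap.integral_apply hi, ContinuousLinearMap.integral_apply
    (hi.apply_continuousLinearMap u)] at h3
  have e : ∀ x, (Real.exp (ℓ θ₀ x) • S₂ θ₀ x +
      (Real.exp (ℓ θ₀ x) • S₁ θ₀ x).smulRight (S₁ θ₀ x)) u v =
      Real.exp (ℓ θ₀ x) * S₂ θ₀ x u v + Real.exp (ℓ θ₀ x) * (S₁ θ₀ x u * S₁ θ₀ x v) := by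
    intro x; simp [mul_assoc]
  simp_rw [e] at h3
  rw [integral_add] at h3
  · linarith
  · have := (hi1.apply_continuousLinearMap u).apply_continuousLinearMap v
    simpa using this
  · have := (hi2.apply_continuousLinearMap u).apply_continuousLinearMap v
    simpa [mul_assoc] using this

/-- Means of a function that is continuous in the parameter and suitably dominated are
continuous in the parameter. -/
theorem tendsto_integral (h : RegularFamily vol ℓ S₁ S₂ b w θ₀ r C) {g : E → X → ℝ}
    (hg : ∀ θ ∈ Metric.ball θ₀ r, AEStronglyMeasurable (g θ) vol)
    (hc : ∀ x, ContinuousAt (fun θ => g θ x) θ₀) {K : ℝ} {j : ℕ} (hj : j ≤ 3)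
    (hb : ∀ θ ∈ Metric.ball θ₀ r, ∀ x, ‖g θ x‖ ≤ K * b x ^ j) :
    Tendsto (fun θ => ∫ x, Real.exp (ℓ θ x) * g θ x ∂vol) (𝓝 θ₀)
      (𝓝 (∫ x, Real.exp (ℓ θ₀ x) * g θ₀ x ∂vol)) := by
  have hball := Metric.ball_mem_nhds θ₀ h.pos
  refine tendsto_integral_filter_of_dominated_convergence (fun x => K * (b x ^ j * w x)) ?_ ?_
    ((h.integrable_pow hj).const_mul K) (Eventually.of_forall fun x => ?_)
  · filter_upwards [hball] with θ hθ
    exact (h.measurable θ hθ).exp.aestronglyMeasurable.mul (hg θ hθ)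
  · filter_upwards [hball] with θ hθ
    refine Eventually.of_forall fun x => ?_
    rw [norm_mul, Real.norm_of_nonneg (Real.exp_pos _).le]
    calc Real.exp (ℓ θ x) * ‖g θ x‖ ≤ w x * (K * b x ^ j) :=
          mul_le_mul (h.exp_le θ hθ x) (hb θ hθ x) (norm_nonneg _) (h.w_nonneg x)
      _ = _ := by ring
  · have h1 := (h.hasFDerivAt θ₀ (Metric.mem_ball_self h.pos) x).continuousAt
    exact h1.rexp.mul (hc x)

end RegularFamily

end Regular

/-! ### Quadratic expansion of the log-likelihood. -/

section Expansion

theorem apply_apply_eq_sum {ι : Type*} [Fintype ι] [DecidableEq ι]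
    (B : EuclideanSpace ℝ ι →L[ℝ] EuclideanSpace ℝ ι →L[ℝ] ℝ) (u v : EuclideanSpace ℝ ι) :
    B u v = ∑ i, ∑ j, u i * v j *
      B (EuclideanSpace.single i 1) (EuclideanSpace.single j 1) := by
  have hu : ∀ u : EuclideanSpace ℝ ι, u = ∑ i, u i • EuclideanSpace.single i (1 : ℝ) := fun u => by
    have := (EuclideanSpace.basisFun ι ℝ).sum_repr u
    simpa using this.symm
  conv_lhs => rw [hu u, hu v]
  simp only [map_sum, map_smul, sum_apply, smul_apply, smul_eq_mul, Finset.mul_sum, mul_assoc]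
  rw [Finset.sum_comm]
  refine Finset.sum_congr rfl fun i _ => Finset.sum_congr rfl fun j _ => ?_
  ring

/-- Reduces a bound uniform over bounded directions to finitely many matrix entries, each governed
by a scalar law of large numbers. -/
theorem abs_apply_apply_le {ι : Type*} [Fintype ι] [DecidableEq ι]
    (B : EuclideanSpace ℝ ι →L[ℝ] EuclideanSpace ℝ ι →L[ℝ] ℝ) (u : EuclideanSpace ℝ ι) :
    |B u u| ≤ ‖u‖ ^ 2 *
      ∑ i, ∑ j, |B (EuclideanSpace.single i 1) (EuclideanSpace.single j 1)| := by
  rw [apply_apply_eq_sum B u u, Finset.mul_sum]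
  refine (Finset.abs_sum_le_sum_abs _ _).trans (Finset.sum_le_sum fun i _ => ?_)
  rw [Finset.mul_sum]
  refine (Finset.abs_sum_le_sum_abs _ _).trans (Finset.sum_le_sum fun j _ => ?_)
  rw [abs_mul, abs_mul, sq]
  have h1 := PiLp.norm_apply_le u i
  have h2 := PiLp.norm_apply_le u j
  rw [Real.norm_eq_abs] at h1 h2
  gcongr

/-- Absorbs a deterministic error that is eventually below every `ε`, uniformly in the sample. -/
theorem IsLittleOP.of_forall_eventually_le {Ω : ℕ → Type*} [∀ n, MeasurableSpace (Ω n)]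
    {P : ∀ n, Measure (Ω n)} {R S : ∀ n, Ω n → ℝ} (hS : IsLittleOP P S)
    (h : ∀ ε > 0, ∀ᶠ n in atTop, ∀ ω, |R n ω| ≤ ε + |S n ω|) : IsLittleOP P R := by
  intro ε hε
  refine tendsto_of_tendsto_of_tendsto_of_le_of_le' tendsto_const_nhds (hS (ε / 2) (half_pos hε))
    (Eventually.of_forall fun _ => zero_le) ?_
  filter_upwards [h (ε / 2) (half_pos hε)] with n hn
  refine measure_mono fun ω hω => ?_
  simp only [Set.mem_ofPred_eq] at hω ⊢
  linarith [hn ω]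

variable {ι X : Type*} [Fintype ι] [MeasurableSpace X] {vol : Measure X}
  {ℓ : EuclideanSpace ℝ ι → X → ℝ} {S₁ : EuclideanSpace ℝ ι → X → EuclideanSpace ℝ ι →L[ℝ] ℝ}
  {S₂ : EuclideanSpace ℝ ι → X → EuclideanSpace ℝ ι →L[ℝ] EuclideanSpace ℝ ι →L[ℝ] ℝ}
  {b w : X → ℝ} {θ₀ : EuclideanSpace ℝ ι} {r C : ℝ}

namespace RegularFamily

/-- The mean of the second derivative of the log-density, as a bilinear form. -/
theorem integral_hess_apply (h : RegularFamily vol ℓ S₁ S₂ b w θ₀ r C)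
    (u v : EuclideanSpace ℝ ι) :
    (∫ x, Real.exp (ℓ θ₀ x) • S₂ θ₀ x ∂vol) u v =
      -∫ x, Real.exp (ℓ θ₀ x) * (S₁ θ₀ x u * S₁ θ₀ x v) ∂vol := by
  have hθ := Metric.mem_ball_self h.pos (x := θ₀)
  have hi : Integrable (fun x => Real.exp (ℓ θ₀ x) • S₂ θ₀ x) vol :=
    h.integrable_of_norm_le hθ (h.measurable₂ θ₀ hθ).aestronglyMeasurable (K := C) (j := 0)
      (by norm_num) (by simpa using h.norm_le₂ θ₀ hθ)
  rw [h.integral_score_mul_score, neg_neg, ContinuousLinearMap.integral_apply hi,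
    ContinuousLinearMap.integral_apply (hi.apply_continuousLinearMap u)]
  simp

/-- Local asymptotic quadratic expansion of the log-likelihood ratio. -/
theorem isLittleOP_expansion [DecidableEq ι] (h : RegularFamily vol ℓ S₁ S₂ b w θ₀ r C)
    (Q : ℕ → Measure X) [∀ n, IsProbabilityMeasure (Q n)] {θ η : ℕ → EuclideanSpace ℝ ι}
    (hθ : Tendsto θ atTop (𝓝 θ₀))
    (hQ : ∀ᶠ n in atTop, Q n = vol.withDensity fun x => ENNReal.ofReal (Real.exp (ℓ (θ n) x)))
    {K : ℝ} (hη : ∀ n, ‖η n‖ ≤ K) :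
    IsLittleOP (fun n => Measure.pi fun _ : Fin n => Q n) fun n x =>
      ∑ i, (ℓ (θ n + (√(n : ℝ))⁻¹ • η n) (x i) - ℓ (θ n) (x i)) -
        ((√(n : ℝ))⁻¹ * ∑ i, S₁ (θ n) (x i) (η n) +
          1 / 2 * (∫ x, Real.exp (ℓ θ₀ x) • S₂ θ₀ x ∂vol) (η n) (η n)) := by
  have hθ₀ := Metric.mem_ball_self h.pos (x := θ₀)
  set A := ∫ x, Real.exp (ℓ θ₀ x) • S₂ θ₀ x ∂vol with hA
  have hK : 0 ≤ K := (norm_nonneg _).trans (hη 0)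
  set e : ι → EuclideanSpace ℝ ι := fun i => EuclideanSpace.single i 1 with he
  -- The Hessian is frozen at `θ₀` while the observations follow `θ n`; dominated convergence makes
  -- the means converge.
  have hlln : ∀ i j, IsLittleOP (fun n => Measure.pi fun _ : Fin n => Q n) fun n x =>
      (n : ℝ)⁻¹ * ∑ l, S₂ θ₀ (x l) (e i) (e j) - A (e i) (e j) := fun i j => by
    have hg : StronglyMeasurable fun x => S₂ θ₀ x (e i) (e j) :=
      ((ContinuousLinearMap.apply ℝ ℝ (e j)).comp
        (ContinuousLinearMap.apply ℝ (EuclideanSpace ℝ ι →L[ℝ] ℝ) (e i))).continuous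
        |>.comp_stronglyMeasurable (h.measurable₂ θ₀ hθ₀)
    have hb : ∀ x, |S₂ θ₀ x (e i) (e j)| ≤ C * ‖e i‖ * ‖e j‖ := fun x => by
      rw [← Real.norm_eq_abs]
      refine (ContinuousLinearMap.le_opNorm₂ _ _ _).trans ?_
      gcongr
      exact h.norm_le₂ θ₀ hθ₀ x
    refine isLittleOP_average_sub Q hg.measurable hb ?_
    have h1 := (h.tendsto_integral (g := fun _ x => S₂ θ₀ x (e i) (e j))
      (fun _ _ => hg.aestronglyMeasurable) (fun x => continuousAt_const)
      (K := C * ‖e i‖ * ‖e j‖) (j := 0) (by norm_num)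
      (fun _ _ x => by simpa using hb x)).comp hθ
    -- Using the information identity forwards and backwards moves the evaluation inside the
    -- integral.
    have h2 : A (e i) (e j) = ∫ x, Real.exp (ℓ θ₀ x) * S₂ θ₀ x (e i) (e j) ∂vol := by
      rw [hA, h.integral_hess_apply, h.integral_score_mul_score, neg_neg]
    rw [h2]
    refine h1.congr' ?_
    filter_upwards [hQ, hθ (Metric.ball_mem_nhds θ₀ h.pos)] with n hn hn'
    rw [hn, integral_withDensity_exp vol (h.measurable _ hn')]
    rfl
  have hsum := (IsLittleOP.sum (P := fun n => Measure.pi fun _ : Fin n => Q n) Finset.univ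
    fun i _ => IsLittleOP.sum Finset.univ fun j _ => (hlln i j).abs).const_mul (1 / 2 * K ^ 2)
  refine hsum.of_forall_eventually_le fun ε hε => ?_
  -- Each of the `n` remainders is at most this modulus times `K ^ 2 / n`, so they add up to at most
  -- `ε`.
  have hε' : 0 < ε / (K ^ 2 + 1) := by positivity
  obtain ⟨ρ, hρ, hball⟩ := Metric.eventually_nhds_iff_ball.1
    ((h.equicontinuous _ hε').and (Metric.ball_mem_nhds θ₀ h.pos))
  have hshift : Tendsto (fun n : ℕ => θ n + (√(n : ℝ))⁻¹ • η n) atTop (𝓝 θ₀) := by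
    have h2 : Tendsto (fun n : ℕ => (√(n : ℝ))⁻¹ • η n) atTop (𝓝 0) :=
      tendsto_inv_sqrt_natCast.zero_smul_isBoundedUnder_le (isBoundedUnder_of ⟨K, hη⟩)
    simpa using hθ.add h2
  filter_upwards [hθ (Metric.ball_mem_nhds θ₀ hρ), hshift (Metric.ball_mem_nhds θ₀ hρ),
    eventually_gt_atTop 0] with n hn1 hn2 hn x
  have hn' : (0 : ℝ) < n := by exact_mod_cast hn
  have hsq : ((√(n : ℝ))⁻¹) ^ 2 = (n : ℝ)⁻¹ := by rw [inv_pow, Real.sq_sqrt hn'.le]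
  have hT : ∀ y : X, |ℓ (θ n + (√(n : ℝ))⁻¹ • η n) y - ℓ (θ n) y -
      S₁ (θ n) y ((√(n : ℝ))⁻¹ • η n) -
      1 / 2 * S₂ θ₀ y ((√(n : ℝ))⁻¹ • η n) ((√(n : ℝ))⁻¹ • η n)| ≤
      ε / (K ^ 2 + 1) * ‖(√(n : ℝ))⁻¹ • η n‖ ^ 2 := fun y =>
    abs_taylor_two_sub_le (convex_ball θ₀ ρ) (f := fun θ => ℓ θ y) (D₁ := fun θ => S₁ θ y)
      (D₂ := fun θ => S₂ θ y)
      (fun θ hθ => h.hasFDerivAt θ (hball θ hθ).2 y)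
      (fun θ hθ => h.hasFDerivAt' θ (hball θ hθ).2 y) (S₂ θ₀ y)
      (fun θ hθ => (hball θ hθ).1 y) hn1 hn2
  have hnorm : ‖(√(n : ℝ))⁻¹ • η n‖ ^ 2 ≤ (n : ℝ)⁻¹ * K ^ 2 := by
    rw [norm_smul, mul_pow, Real.norm_eq_abs, sq_abs, hsq]
    have := hη n
    gcongr
  have hfirst : |∑ l, (ℓ (θ n + (√(n : ℝ))⁻¹ • η n) (x l) - ℓ (θ n) (x l) -
      S₁ (θ n) (x l) ((√(n : ℝ))⁻¹ • η n) -
      1 / 2 * S₂ θ₀ (x l) ((√(n : ℝ))⁻¹ • η n) ((√(n : ℝ))⁻¹ • η n))| ≤ ε := by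
    refine (Finset.abs_sum_le_sum_abs _ _).trans ?_
    calc _ ≤ ∑ _l : Fin n, ε / (K ^ 2 + 1) * ((n : ℝ)⁻¹ * K ^ 2) :=
          Finset.sum_le_sum fun l _ => (hT (x l)).trans (by gcongr)
      _ = ε * (K ^ 2 / (K ^ 2 + 1)) := by
          rw [Finset.sum_const, Finset.card_univ, Fintype.card_fin, nsmul_eq_mul]
          field_simp
      _ ≤ ε * 1 := by
          gcongr
          rw [div_le_one (by positivity)]
          linarith
      _ = ε := mul_one _
  set B : EuclideanSpace ℝ ι →L[ℝ] EuclideanSpace ℝ ι →L[ℝ] ℝ :=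
    (n : ℝ)⁻¹ • ∑ l, S₂ θ₀ (x l) - A with hB
  have hBapp : ∀ u v, B u v = (n : ℝ)⁻¹ * ∑ l, S₂ θ₀ (x l) u v - A u v := fun u v => by
    simp [hB]
  have hsecond : |1 / 2 * B (η n) (η n)| ≤ |(1 / 2 * K ^ 2 * ∑ i, ∑ j,
      |(n : ℝ)⁻¹ * ∑ l, S₂ θ₀ (x l) (e i) (e j) - A (e i) (e j)|)| := by
    simp only [← hBapp]
    refine le_trans ?_ (le_abs_self _)
    rw [abs_mul, abs_of_nonneg (by norm_num : (0 : ℝ) ≤ 1 / 2), mul_assoc]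
    refine mul_le_mul_of_nonneg_left ?_ (by norm_num)
    refine (abs_apply_apply_le B (η n)).trans ?_
    have := hη n
    gcongr
  -- The error splits into the Taylor remainders and the fluctuation `B` of the averaged Hessian.
  have hdecomp : ∑ i, (ℓ (θ n + (√(n : ℝ))⁻¹ • η n) (x i) - ℓ (θ n) (x i)) -
        ((√(n : ℝ))⁻¹ * ∑ i, S₁ (θ n) (x i) (η n) + 1 / 2 * A (η n) (η n)) =
      ∑ l, (ℓ (θ n + (√(n : ℝ))⁻¹ • η n) (x l) - ℓ (θ n) (x l) -
        S₁ (θ n) (x l) ((√(n : ℝ))⁻¹ • η n) -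
        1 / 2 * S₂ θ₀ (x l) ((√(n : ℝ))⁻¹ • η n) ((√(n : ℝ))⁻¹ • η n)) +
      1 / 2 * B (η n) (η n) := by
    rw [hBapp, ← hsq]
    simp only [map_smul, smul_apply, smul_eq_mul, Finset.sum_sub_distrib, ← Finset.mul_sum]
    ring
  rw [hdecomp]
  exact (abs_add_le _ _).trans (add_le_add hfirst hsecond)

end RegularFamily

end Expansion

/-! ### The Student density integrates to one. -/

section Normalization

theorem lintegral_rpow_mul_exp_neg_mul_Ioi {a r : ℝ} (ha : 0 < a) (hr : 0 < r) :
    ∫⁻ t in Set.Ioi (0 : ℝ), ENNReal.ofReal (t ^ (a - 1) * Real.exp (-(r * t))) =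
      ENNReal.ofReal ((1 / r) ^ a * Real.Gamma a) := by
  have h := Real.integral_rpow_mul_exp_neg_mul_Ioi ha hr
  have hG := Real.Gamma_pos_of_pos ha
  rw [← h, ofReal_integral_eq_lintegral_ofReal]
  -- A Bochner integral with nonzero value forces integrability.
  · refine not_imp_comm.1 integral_undef ?_
    rw [h]
    positivity
  · filter_upwards [self_mem_ae_restrict measurableSet_Ioi] with t ht
    have : (0 : ℝ) < t := ht
    positivity

theorem lintegral_exp_neg_mul_norm_sq (k : ℕ) {c : ℝ} (hc : 0 < c) :
    ∫⁻ x : EuclideanSpace ℝ (Fin k), ENNReal.ofReal (Real.exp (-c * ‖x‖ ^ 2)) =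
      ENNReal.ofReal ((Real.pi / c) ^ ((k : ℝ) / 2)) := by
  have h := GaussianFourier.integral_rexp_neg_mul_sq_norm (V := EuclideanSpace ℝ (Fin k)) hc
  rw [finrank_euclideanSpace_fin] at h
  rw [← h, ofReal_integral_eq_lintegral_ofReal]
  · refine not_imp_comm.1 integral_undef ?_
    rw [h]
    positivity
  · exact Eventually.of_forall fun x => (Real.exp_pos _).le

/-- The spherical Student `t` integral. -/
theorem lintegral_one_add_norm_sq_div_rpow (k : ℕ) {ν : ℝ} (hν : 0 < ν) :
    ∫⁻ x : EuclideanSpace ℝ (Fin k),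
      ENNReal.ofReal ((1 + ‖x‖ ^ 2 / ν) ^ (-((ν + k) / 2))) =
      ENNReal.ofReal (normConst k ν)⁻¹ := by
  set s := (ν + k) / 2 with hs
  have hspos : 0 < s := by positivity
  have hGs := Real.Gamma_pos_of_pos hspos
  have hGν := Real.Gamma_pos_of_pos (half_pos hν)
  -- A Gamma integral writes the density as a scale mixture of Gaussians; Tonelli's theorem then
  -- leaves a Gaussian integral in `x` and a Gamma integral in `t`.
  have e1 : ∀ x : EuclideanSpace ℝ (Fin k),
      ENNReal.ofReal ((1 + ‖x‖ ^ 2 / ν) ^ (-s)) * ENNReal.ofReal (Real.Gamma s) =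
      ∫⁻ t in Set.Ioi (0 : ℝ),
        ENNReal.ofReal (t ^ (s - 1) * Real.exp (-((1 + ‖x‖ ^ 2 / ν) * t))) := fun x => by
    have hpos : 0 < 1 + ‖x‖ ^ 2 / ν := by positivity
    rw [lintegral_rpow_mul_exp_neg_mul_Ioi hspos hpos, ← ENNReal.ofReal_mul (by positivity),
      Real.rpow_neg hpos.le, one_div, Real.inv_rpow hpos.le]
  have e2 : (∫⁻ x : EuclideanSpace ℝ (Fin k), ENNReal.ofReal ((1 + ‖x‖ ^ 2 / ν) ^ (-s))) *
      ENNReal.ofReal (Real.Gamma s) =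
      ENNReal.ofReal ((Real.pi * ν) ^ ((k : ℝ) / 2) * Real.Gamma (ν / 2)) := by
    rw [← lintegral_mul_const _ (by fun_prop)]
    simp_rw [e1]
    rw [lintegral_lintegral_swap (by fun_prop)]
    have e3 : ∀ t ∈ Set.Ioi (0 : ℝ), ∫⁻ x : EuclideanSpace ℝ (Fin k),
        ENNReal.ofReal (t ^ (s - 1) * Real.exp (-((1 + ‖x‖ ^ 2 / ν) * t))) =
        ENNReal.ofReal ((Real.pi * ν) ^ ((k : ℝ) / 2)) *
          ENNReal.ofReal (t ^ (ν / 2 - 1) * Real.exp (-(1 * t))) := fun t ht => by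
      have ht' : (0 : ℝ) < t := ht
      have e4 : ∀ x : EuclideanSpace ℝ (Fin k),
          ENNReal.ofReal (t ^ (s - 1) * Real.exp (-((1 + ‖x‖ ^ 2 / ν) * t))) =
          ENNReal.ofReal (t ^ (s - 1) * Real.exp (-t)) *
            ENNReal.ofReal (Real.exp (-(t / ν) * ‖x‖ ^ 2)) := fun x => by
        rw [← ENNReal.ofReal_mul (by positivity), mul_assoc, ← Real.exp_add]
        congr 3
        ring
      simp_rw [e4]
      rw [lintegral_const_mul _ (by fun_prop), lintegral_exp_neg_mul_norm_sq k (by positivity),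
        ← ENNReal.ofReal_mul (by positivity), ← ENNReal.ofReal_mul (by positivity)]
      congr 1
      have e5 : Real.pi / (t / ν) = Real.pi * ν * t⁻¹ := by field_simp
      have e6 : t ^ (s - 1) = t ^ (ν / 2 - 1) * t ^ ((k : ℝ) / 2) := by
        rw [← Real.rpow_add ht']
        congr 1
        rw [hs]
        ring
      have e7 : t ^ ((k : ℝ) / 2) * (t ^ ((k : ℝ) / 2))⁻¹ = 1 :=
        mul_inv_cancel₀ (by positivity)
      rw [e5, Real.mul_rpow (by positivity) (by positivity), Real.inv_rpow ht'.le, e6, one_mul]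
      linear_combination (t ^ (ν / 2 - 1) * Real.exp (-t) * (Real.pi * ν) ^ ((k : ℝ) / 2)) * e7
    rw [setLIntegral_congr_fun measurableSet_Ioi e3, lintegral_const_mul _ (by fun_prop),
      lintegral_rpow_mul_exp_neg_mul_Ioi (half_pos hν) one_pos,
      ← ENNReal.ofReal_mul (by positivity)]
    simp
  have hG0 : ENNReal.ofReal (Real.Gamma s) ≠ 0 := by simpa using hGs
  rw [← ENNReal.mul_left_inj hG0 ENNReal.ofReal_ne_top, e2,
    ← ENNReal.ofReal_mul (by unfold normConst; positivity), normConst, ← hs]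
  congr 1
  field_simp

-- A nonnegative element of a C*-algebra has the form `star y * y`. The factor `B` turns the
-- Mahalanobis norm into the Euclidean norm.
open scoped MatrixOrder Matrix.Norms.L2Operator in
theorem exists_inv_eq_transpose_mul_self {k : ℕ} {S : Matrix (Fin k) (Fin k) ℝ} (hS : S.PosDef) :
    ∃ B : Matrix (Fin k) (Fin k) ℝ, S⁻¹ = Bᵀ * B := by
  obtain ⟨y, hy⟩ := CStarAlgebra.nonneg_iff_eq_star_mul_self.mp hS.inv.posSemidef.nonneg
  exact ⟨y, by simpa [Matrix.star_eq_conjTranspose] using hy⟩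

theorem normConst_pos (k : ℕ) {ν : ℝ} (hν : 0 < ν) : 0 < normConst k ν := by
  have h1 : 0 < Real.Gamma ((ν + k) / 2) := Real.Gamma_pos_of_pos (by positivity)
  have h2 : 0 < Real.Gamma (ν / 2) := Real.Gamma_pos_of_pos (by positivity)
  unfold normConst
  positivity

theorem mahalanobisSq_nonneg {k : ℕ} {S : Matrix (Fin k) (Fin k) ℝ} (hS : S.PosDef)
    (μ x : EuclideanSpace ℝ (Fin k)) : 0 ≤ mahalanobisSq μ S x := by
  have := hS.inv.posSemidef.dotProduct_mulVec_nonneg (x - μ).ofLp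
  simpa [mahalanobisSq] using this

theorem density_pos {k : ℕ} {V : Triple k} (hV : V ∈ paramSpace k)
    (x : EuclideanSpace ℝ (Fin k)) : 0 < density V x := by
  have h1 := normConst_pos k hV.2
  have h2 := hV.1.det_pos
  have h3 := mahalanobisSq_nonneg hV.1 V.1 x
  have h4 := hV.2
  unfold density
  positivity

/-- The substitution `y = B (x - μ)` reduces to the spherical case, and its Jacobian factor `|det
B|⁻¹` cancels the determinant in the density. -/
theorem lintegral_density {k : ℕ} {V : Triple k} (hV : V ∈ paramSpace k) :
    ∫⁻ x, ENNReal.ofReal (density V x) = 1 := by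
  obtain ⟨μ, S, ν⟩ := V
  obtain ⟨hS, hν⟩ := hV
  simp only at hS hν
  obtain ⟨B, hB⟩ := exists_inv_eq_transpose_mul_self hS
  have hdet : 0 < S.det := hS.det_pos
  have hdB : B.det ^ 2 = S.det⁻¹ := by
    have := congrArg Matrix.det hB
    rw [Matrix.det_mul, Matrix.det_transpose, Matrix.det_nonsing_inv,
      Ring.inverse_eq_inv'] at this
    rw [this, sq]
  have hB0 : B.det ≠ 0 := by
    intro h
    rw [h] at hdB
    have := inv_pos.2 hdet
    norm_num at hdB
    exact hdet.ne' hdB.symm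
  set T := Matrix.toLpLin 2 2 B with hT
  have hTdet : LinearMap.det T = B.det := LinearMap.det_toLpLin 2 B
  have hQ : ∀ x, mahalanobisSq μ S x = ‖T (x - μ)‖ ^ 2 := fun x => by
    rw [mahalanobisSq, hB, EuclideanSpace.real_norm_sq_eq, ← Matrix.mulVec_mulVec,
      Matrix.dotProduct_mulVec, Matrix.vecMul_transpose]
    simp [hT, dotProduct, sq, Matrix.toLpLin_apply]
  have hc := normConst_pos k hν
  have e1 : ∀ x, ENNReal.ofReal (density (μ, S, ν) x) =
      ENNReal.ofReal (normConst k ν * S.det ^ (-(1 / 2 : ℝ))) *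
        ENNReal.ofReal ((1 + ‖T (x - μ)‖ ^ 2 / ν) ^ (-((ν + k) / 2))) := fun x => by
    rw [← ENNReal.ofReal_mul (by positivity), ← hQ]
    rfl
  have hTm : Measurable T := (LinearMap.continuous_of_finiteDimensional T).measurable
  simp_rw [e1]
  rw [lintegral_const_mul _ (by fun_prop),
    lintegral_sub_right_eq_self (μ := volume)
      (fun x => ENNReal.ofReal ((1 + ‖T x‖ ^ 2 / ν) ^ (-((ν + k) / 2)))) μ,
    ← lintegral_map (μ := volume)
      (f := fun y => ENNReal.ofReal ((1 + ‖y‖ ^ 2 / ν) ^ (-((ν + k) / 2)))) (by fun_prop) hTm,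
    Measure.map_linearMap_addHaar_eq_smul_addHaar volume (by rwa [hTdet]), lintegral_smul_measure,
    lintegral_one_add_norm_sq_div_rpow k hν, smul_eq_mul, hTdet,
    ← ENNReal.ofReal_mul (by positivity), ← ENNReal.ofReal_mul (by positivity)]
  have h1 : |B.det⁻¹| = S.det ^ (1 / 2 : ℝ) := by
    rw [← Real.sqrt_eq_rpow, ← Real.sqrt_sq_eq_abs, inv_pow, hdB, inv_inv]
  rw [h1, Real.rpow_neg hdet.le, ← ENNReal.ofReal_one]
  congr 1
  have : S.det ^ (1 / 2 : ℝ) ≠ 0 := by positivity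
  field_simp

theorem isProbabilityMeasure_law {k : ℕ} {V : Triple k} (hV : V ∈ paramSpace k) :
    IsProbabilityMeasure (law V) :=
  ⟨by rw [law, withDensity_apply _ .univ, Measure.restrict_univ, lintegral_density hV]⟩

end Normalization

/-! ### Smoothness of the ingredients of the density. -/

section Smoothness

/-- The complex Gamma function is holomorphic on the right half-plane, hence smooth there, and so is
its restriction to the real axis. -/
theorem contDiffAt_realGamma {n : WithTop ℕ∞} {s : ℝ} (hs : 0 < s) :
    ContDiffAt ℝ n Real.Gamma s := by
  have hopen : IsOpen {z : ℂ | 0 < z.re} := isOpen_lt continuous_const Complex.continuous_re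
  have hd : DifferentiableOn ℂ Complex.Gamma {z : ℂ | 0 < z.re} := fun z hz =>
    (Complex.differentiableAt_Gamma z fun m h => by
      have h' : (0 : ℝ) < z.re := hz
      rw [h] at h'
      simp only [Complex.neg_re, Complex.natCast_re] at h'
      linarith [m.cast_nonneg (α := ℝ)]).differentiableWithinAt
  exact ((hd.contDiffOn hopen).contDiffAt
    (hopen.mem_nhds (show (0 : ℝ) < (s : ℂ).re by simpa using hs))).real_of_complex

variable {F : Type*} [NormedAddCommGroup F] [NormedSpace ℝ F] {n : WithTop ℕ∞}

theorem contDiffAt_normConst (k : ℕ) {ν : F → ℝ} {p : F} (hν : ContDiffAt ℝ n ν p)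
    (h0 : 0 < ν p) : ContDiffAt ℝ n (fun q => normConst k (ν q)) p := by
  unfold normConst
  have h1 : ContDiffAt ℝ n (fun q => Real.Gamma ((ν q + k) / 2)) p :=
    ContDiffAt.comp (g := Real.Gamma) p
      (contDiffAt_realGamma (s := (ν p + k) / 2) (by positivity))
      ((hν.add contDiffAt_const).div_const 2)
  have h2 : ContDiffAt ℝ n (fun q => Real.Gamma (ν q / 2)) p :=
    ContDiffAt.comp (g := Real.Gamma) p (contDiffAt_realGamma (s := ν p / 2) (by positivity))
      (hν.div_const 2)
  have h3 : ContDiffAt ℝ n (fun q => (Real.pi * ν q) ^ ((k : ℝ) / 2)) p :=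
    (contDiffAt_const.mul hν).rpow_const_of_ne (by positivity)
  refine h1.div (h3.mul h2) ?_
  have := Real.Gamma_pos_of_pos (half_pos h0)
  positivity

theorem contDiffAt_det {k : ℕ} {M : F → Matrix (Fin k) (Fin k) ℝ} {p : F}
    (hM : ∀ i j, ContDiffAt ℝ n (fun q => M q i j) p) :
    ContDiffAt ℝ n (fun q => (M q).det) p := by
  simp only [Matrix.det_apply]
  refine ContDiffAt.sum fun σ _ => ContDiffAt.const_smul _ ?_
  exact contDiffAt_prod fun i _ => hM _ _

/-- Cramer's rule: entries of the inverse are cofactors divided by the determinant. -/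
theorem contDiffAt_inv_apply {k : ℕ} {M : F → Matrix (Fin k) (Fin k) ℝ} {p : F}
    (hM : ∀ i j, ContDiffAt ℝ n (fun q => M q i j) p) (h0 : (M p).det ≠ 0) (i j : Fin k) :
    ContDiffAt ℝ n (fun q => (M q)⁻¹ i j) p := by
  simp only [Matrix.inv_def, Ring.inverse_eq_inv', Matrix.smul_apply, smul_eq_mul,
    Matrix.adjugate_apply]
  refine ((contDiffAt_det hM).inv h0).mul (contDiffAt_det fun a b => ?_)
  simp only [Matrix.updateRow_apply]
  split_ifs
  · exact contDiffAt_const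
  · exact hM a b

end Smoothness

/-! ### Coordinates on the parameter space. -/

section Coordinates

variable {k : ℕ}

theorem unvech_isSymm (v : UpperIdx k → ℝ) : (unvech v).IsSymm := by
  ext i j
  simp [unvech, min_comm, max_comm]

/-- The score is differentiated through `ofCoords`; this identifies the resulting function with the
density at `V` itself. -/
theorem ofCoords_coords {V : Triple k} (hV : V.2.1.IsSymm) : ofCoords (coords V) = V := by
  obtain ⟨μ, S, ν⟩ := V
  refine Prod.ext rfl (Prod.ext ?_ rfl)
  ext i j
  change S (min i j) (max i j) = S i j
  rcases le_total i j with h | h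
  · rw [min_eq_left h, max_eq_right h]
  · rw [min_eq_right h, max_eq_left h]
    exact hV.apply i j

theorem isSymm_of_mem_paramSpace {V : Triple k} (hV : V ∈ paramSpace k) : V.2.1.IsSymm := by
  have := hV.1.isHermitian
  rwa [Matrix.IsHermitian, Matrix.conjTranspose_eq_transpose_of_trivial] at this

theorem coords_add_smul (V τ : Triple k) (c : ℝ) :
    coords (V + c • τ) = coords V + c • coords τ := by
  ext i
  rcases i with i | i | i <;> simp [coords, vech]

/-- The coordinate vectors of the parameters. -/
def coordSpace (k : ℕ) : Set (EuclideanSpace ℝ (CoordIdx k)) :=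
  {θ | ofCoords θ ∈ paramSpace k}

theorem coords_mem_coordSpace {V : Triple k} (hV : V ∈ paramSpace k) :
    coords V ∈ coordSpace k := by
  rw [coordSpace, Set.mem_ofPred_eq, ofCoords_coords (isSymm_of_mem_paramSpace hV)]
  exact hV

/-- Symmetry is built into `unvech`, and positivity of a quadratic form need only be tested on the
compact unit sphere, where it persists under small perturbations. -/
theorem isOpen_coordSpace (k : ℕ) : IsOpen (coordSpace k) := by
  rw [isOpen_iff_eventually]
  intro θ₀ hθ₀
  have hν : ∀ᶠ θ in 𝓝 θ₀, 0 < (ofCoords θ).2.2 := by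
    have hc : Continuous fun θ : EuclideanSpace ℝ (CoordIdx k) => (ofCoords θ).2.2 := by
      simp only [ofCoords]
      fun_prop
    exact hc.continuousAt.eventually (lt_mem_nhds hθ₀.2)
  have hc : Continuous fun p : EuclideanSpace ℝ (CoordIdx k) × EuclideanSpace ℝ (Fin k) =>
      p.2.ofLp ⬝ᵥ ((ofCoords p.1).2.1 *ᵥ p.2.ofLp) := by
    simp only [ofCoords, unvech, dotProduct, Matrix.mulVec, Matrix.of_apply]
    fun_prop
  have hS : ∀ᶠ θ in 𝓝 θ₀, ∀ x ∈ Metric.sphere (0 : EuclideanSpace ℝ (Fin k)) 1,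
      0 < x.ofLp ⬝ᵥ ((ofCoords θ).2.1 *ᵥ x.ofLp) := by
    refine (isCompact_sphere _ _).eventually_forall_of_forall_eventually fun x hx => ?_
    refine hc.continuousAt.eventually (lt_mem_nhds ?_)
    have hx0 : x ≠ 0 := by
      rintro rfl
      simp at hx
    have := hθ₀.1.dotProduct_mulVec_pos (x := x.ofLp)
      (fun h => hx0 ((WithLp.ofLp_injective 2) (by simpa using h)))
    simpa using this
  filter_upwards [hν, hS] with θ h1 h2
  refine ⟨Matrix.PosDef.of_dotProduct_mulVec_pos ?_ fun x hx => ?_, h1⟩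
  · rw [Matrix.IsHermitian, Matrix.conjTranspose_eq_transpose_of_trivial]
    exact (unvech_isSymm fun p => θ (Sum.inr (Sum.inl p))).eq
  · have hx0 : WithLp.toLp 2 x ≠ 0 := fun h => hx (by simpa using h)
    have hn : 0 < ‖WithLp.toLp 2 x‖ := norm_pos_iff.2 hx0
    have := h2 (‖WithLp.toLp 2 x‖⁻¹ • WithLp.toLp 2 x) (by
      simp [norm_smul, hn.ne'])
    simp only [WithLp.ofLp_smul, Matrix.mulVec_smul, dotProduct_smul, smul_dotProduct,
      smul_eq_mul] at this
    have h3 := pos_of_mul_pos_right (pos_of_mul_pos_right this (inv_pos.2 hn).le)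
      (inv_pos.2 hn).le
    simpa using h3

end Coordinates

/-! ### Compactification of the observation space by the sphere. -/

section Homogenization

variable {k : ℕ}

/-- The homogenized form of `1 + mahalanobisSq / ν`: a quadratic form in `(a, b) ∈ ℝ × ℝ^k`. -/
noncomputable def homForm (θ : EuclideanSpace ℝ (CoordIdx k))
    (y : ℝ × EuclideanSpace ℝ (Fin k)) : ℝ :=
  y.1 ^ 2 + mahalanobisSq (y.1 • (ofCoords θ).1) (ofCoords θ).2.1 y.2 / (ofCoords θ).2.2

/-- The log-density without its logarithmically growing part, in homogeneous coordinates. -/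
noncomputable def homLogDensity
    (p : EuclideanSpace ℝ (CoordIdx k) × (ℝ × EuclideanSpace ℝ (Fin k))) : ℝ :=
  Real.log (normConst k (ofCoords p.1).2.2) - 1 / 2 * Real.log (ofCoords p.1).2.1.det -
    ((ofCoords p.1).2.2 + k) / 2 * Real.log (homForm p.1 p.2)

/-- Off the equator the square of the first coordinate is positive; on it the form is the positive
definite `Σ⁻¹` form divided by `ν`. -/
theorem homForm_pos {θ : EuclideanSpace ℝ (CoordIdx k)} (hθ : θ ∈ coordSpace k)
    {y : ℝ × EuclideanSpace ℝ (Fin k)} (hy : y ≠ 0) : 0 < homForm θ y := by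
  have h0 := hθ.2
  have h1 := mahalanobisSq_nonneg hθ.1 (y.1 • (ofCoords θ).1) y.2
  unfold homForm
  rcases eq_or_ne y.1 0 with h | h
  · have hy2 : y.2 ≠ 0 := fun h' => hy (Prod.ext h h')
    have : 0 < mahalanobisSq (y.1 • (ofCoords θ).1) (ofCoords θ).2.1 y.2 := by
      have := hθ.1.inv.dotProduct_mulVec_pos (x := y.2.ofLp)
        (fun h => hy2 ((WithLp.ofLp_injective 2) (by simpa using h)))
      simpa [mahalanobisSq, h] using this
    positivity
  · positivity

theorem contDiff_scatter_apply {n : WithTop ℕ∞} (i j : Fin k) :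
    ContDiff ℝ n fun θ : EuclideanSpace ℝ (CoordIdx k) => (ofCoords θ).2.1 i j := by
  simp only [ofCoords, unvech, Matrix.of_apply]
  fun_prop

theorem contDiff_tail {n : WithTop ℕ∞} :
    ContDiff ℝ n fun θ : EuclideanSpace ℝ (CoordIdx k) => (ofCoords θ).2.2 := by
  simp only [ofCoords]
  fun_prop

theorem contDiffAt_homForm {n : WithTop ℕ∞}
    {p : EuclideanSpace ℝ (CoordIdx k) × (ℝ × EuclideanSpace ℝ (Fin k))}
    (hp : p.1 ∈ coordSpace k) :
    ContDiffAt ℝ n (fun q : EuclideanSpace ℝ (CoordIdx k) × (ℝ × EuclideanSpace ℝ (Fin k)) =>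
      homForm q.1 q.2) p := by
  unfold homForm
  have hz : ∀ i, ContDiffAt ℝ n
      (fun q : EuclideanSpace ℝ (CoordIdx k) × (ℝ × EuclideanSpace ℝ (Fin k)) =>
        (q.2.2 - q.2.1 • (ofCoords q.1).1).ofLp i) p := fun i => by
    simp only [ofCoords, WithLp.ofLp_sub, WithLp.ofLp_smul, Pi.sub_apply, Pi.smul_apply,
      smul_eq_mul]
    fun_prop
  have hinv : ∀ i j, ContDiffAt ℝ n
      (fun q : EuclideanSpace ℝ (CoordIdx k) × (ℝ × EuclideanSpace ℝ (Fin k)) =>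
        (ofCoords q.1).2.1⁻¹ i j) p := fun i j =>
    contDiffAt_inv_apply
      (M := fun q : EuclideanSpace ℝ (CoordIdx k) × (ℝ × EuclideanSpace ℝ (Fin k)) =>
        (ofCoords q.1).2.1)
      (fun i j => ((contDiff_scatter_apply i j).comp contDiff_fst).contDiffAt)
      hp.1.det_pos.ne' i j
  refine (contDiffAt_snd.fst.pow 2).add (ContDiffAt.div ?_
    (contDiff_tail.comp contDiff_fst).contDiffAt hp.2.ne')
  simp only [mahalanobisSq, dotProduct, Matrix.mulVec]
  exact ContDiffAt.sum fun i _ => (hz i).mul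
    (ContDiffAt.sum fun j _ => (hinv i j).mul (hz j))

/-- Only `y = 0` is excluded: smoothness also holds at first coordinate zero, which represents
observations at infinity. -/
theorem contDiffAt_homLogDensity {n : WithTop ℕ∞}
    {p : EuclideanSpace ℝ (CoordIdx k) × (ℝ × EuclideanSpace ℝ (Fin k))}
    (hp : p.1 ∈ coordSpace k) (hy : p.2 ≠ 0) : ContDiffAt ℝ n homLogDensity p := by
  unfold homLogDensity
  have hν : ContDiffAt ℝ n
      (fun q : EuclideanSpace ℝ (CoordIdx k) × (ℝ × EuclideanSpace ℝ (Fin k)) =>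
        (ofCoords q.1).2.2) p := (contDiff_tail.comp contDiff_fst).contDiffAt
  refine (((contDiffAt_normConst k hν hp.2).log (normConst_pos k hp.2).ne').sub
    (contDiffAt_const.mul (ContDiffAt.log (contDiffAt_det fun i j =>
      ((contDiff_scatter_apply i j).comp contDiff_fst).contDiffAt) hp.1.det_pos.ne'))).sub
    (((hν.add contDiffAt_const).div_const 2).mul
      ((contDiffAt_homForm hp).log (homForm_pos hp hy).ne'))

/-- The logarithm of the squared Japanese bracket. -/
noncomputable def logBracket (x : EuclideanSpace ℝ (Fin k)) : ℝ := Real.log (1 + ‖x‖ ^ 2)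

theorem logBracket_nonneg (x : EuclideanSpace ℝ (Fin k)) : 0 ≤ logBracket x :=
  Real.log_nonneg (by nlinarith [sq_nonneg ‖x‖])

theorem continuous_logBracket : Continuous (logBracket (k := k)) := by
  unfold logBracket
  exact Continuous.log (by fun_prop) fun x => by positivity

/-- The central projection of `(1, x)` to the unit sphere of `ℝ × ℝ^k`. -/
noncomputable def sphereProj (x : EuclideanSpace ℝ (Fin k)) : ℝ × EuclideanSpace ℝ (Fin k) :=
  ((√(1 + ‖x‖ ^ 2))⁻¹, (√(1 + ‖x‖ ^ 2))⁻¹ • x)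

theorem continuous_sphereProj : Continuous (sphereProj (k := k)) := by
  have h : Continuous fun x : EuclideanSpace ℝ (Fin k) => (√(1 + ‖x‖ ^ 2))⁻¹ :=
    Continuous.inv₀ (by fun_prop) fun x => by positivity
  exact h.prodMk (h.smul continuous_id)

/-- The Euclidean unit sphere of `ℝ × ℝ^k`. -/
def sphereSet (k : ℕ) : Set (ℝ × EuclideanSpace ℝ (Fin k)) :=
  {y | y.1 ^ 2 + ‖y.2‖ ^ 2 = 1}

theorem isCompact_sphereSet (k : ℕ) : IsCompact (sphereSet k) := by
  refine Metric.isCompact_of_isClosed_isBounded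
    (isClosed_eq (by fun_prop) continuous_const) ?_
  refine (Metric.isBounded_closedBall (x := (0 : ℝ × EuclideanSpace ℝ (Fin k))) (r := 1)).subset
    fun y hy => ?_
  have hy' : y.1 ^ 2 + ‖y.2‖ ^ 2 = 1 := hy
  rw [mem_closedBall_zero_iff, Prod.norm_def, max_le_iff, Real.norm_eq_abs]
  exact ⟨abs_le_one_iff_mul_self_le_one.2 (by nlinarith [sq_nonneg ‖y.2‖]),
    by nlinarith [sq_nonneg y.1, norm_nonneg y.2]⟩

theorem ne_zero_of_mem_sphereSet {y : ℝ × EuclideanSpace ℝ (Fin k)} (hy : y ∈ sphereSet k) :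
    y ≠ 0 := by
  rintro rfl
  simp [sphereSet] at hy

theorem sphereProj_mem (x : EuclideanSpace ℝ (Fin k)) : sphereProj x ∈ sphereSet k := by
  have h : 0 < 1 + ‖x‖ ^ 2 := by positivity
  simp only [sphereSet, sphereProj, Set.mem_ofPred_eq, norm_smul, mul_pow, inv_pow,
    norm_inv, Real.norm_eq_abs, sq_abs, Real.sq_sqrt h.le]
  field_simp

/-- Homogeneity of degree two. -/
theorem homForm_sphereProj (θ : EuclideanSpace ℝ (CoordIdx k)) (x : EuclideanSpace ℝ (Fin k)) :
    homForm θ (sphereProj x) = (1 + ‖x‖ ^ 2)⁻¹ *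
      (1 + mahalanobisSq (ofCoords θ).1 (ofCoords θ).2.1 x / (ofCoords θ).2.2) := by
  have h : 0 < 1 + ‖x‖ ^ 2 := by positivity
  simp only [homForm, sphereProj, mahalanobisSq, ← smul_sub, WithLp.ofLp_smul, Matrix.mulVec_smul,
    dotProduct_smul, smul_dotProduct, smul_eq_mul]
  have h2 : (√(1 + ‖x‖ ^ 2))⁻¹ ^ 2 = (1 + ‖x‖ ^ 2)⁻¹ := by rw [inv_pow, Real.sq_sqrt h.le]
  rw [← h2]
  ring

/-- Isolates the part that is unbounded in `x`, which is affine in the parameter. -/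
theorem log_density {θ : EuclideanSpace ℝ (CoordIdx k)} (hθ : θ ∈ coordSpace k)
    (x : EuclideanSpace ℝ (Fin k)) :
    Real.log (density (ofCoords θ) x) = homLogDensity (θ, sphereProj x) -
      ((ofCoords θ).2.2 + k) / 2 * logBracket x := by
  have h0 := hθ.2
  have h1 := mahalanobisSq_nonneg hθ.1 (ofCoords θ).1 x
  have h2 := normConst_pos k hθ.2
  have h3 := hθ.1.det_pos
  have h4 : 0 < 1 + mahalanobisSq (ofCoords θ).1 (ofCoords θ).2.1 x / (ofCoords θ).2.2 := by
    positivity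
  have h5 : 0 < 1 + ‖x‖ ^ 2 := by positivity
  rw [density, homLogDensity, Real.log_mul (by positivity) (by positivity),
    Real.log_mul (by positivity) (by positivity), Real.log_rpow h3, Real.log_rpow h4]
  simp only [homForm_sphereProj]
  rw [Real.log_mul (by positivity) h4.ne', Real.log_inv, logBracket]
  ring

theorem integrable_add_mul_logBracket_pow (a c : ℝ) (ha : 0 ≤ a) (hc : 0 ≤ c) {δ : ℝ}
    (hδ : 0 < δ) :
    Integrable fun x : EuclideanSpace ℝ (Fin k) =>
      (a + c * logBracket x) ^ 3 * Real.exp (-((δ + k) / 2 * logBracket x)) := by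
  have hint : Integrable fun x : EuclideanSpace ℝ (Fin k) =>
      ((1 : ℝ) + ‖x‖ ^ 2) ^ (-(k + δ / 2) / 2) :=
    integrable_rpow_neg_one_add_norm_sq (by
      rw [finrank_euclideanSpace_fin]
      linarith)
  have hcont := continuous_logBracket (k := k)
  refine (hint.const_mul ((a + c * (12 / δ)) ^ 3)).mono' (by fun_prop)
    (Eventually.of_forall fun x => ?_)
  have hL := logBracket_nonneg x
  have h5 : 0 < 1 + ‖x‖ ^ 2 := by positivity
  rw [Real.norm_of_nonneg (by positivity), Real.rpow_def_of_pos h5]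
  change _ ≤ _ * Real.exp (logBracket x * _)
  -- With rate `δ / 12` the cube costs `δ / 4`, half of the available `δ / 2`, leaving the exponent
  -- `(k + δ / 2) / 2`, above the integrability threshold `k / 2`.
  have h1 : a + c * logBracket x ≤ (a + c * (12 / δ)) * Real.exp (δ / 12 * logBracket x) := by
    have e1 := Real.add_one_le_exp (δ / 12 * logBracket x)
    have e2 : 1 ≤ Real.exp (δ / 12 * logBracket x) := Real.one_le_exp (by positivity)
    have e3 : logBracket x ≤ 12 / δ * Real.exp (δ / 12 * logBracket x) := by
      calc logBracket x = 12 / δ * (δ / 12 * logBracket x) := by field_simp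
        _ ≤ _ := by gcongr; linarith
    nlinarith [mul_le_mul_of_nonneg_left e3 hc, mul_le_mul_of_nonneg_left e2 ha]
  calc (a + c * logBracket x) ^ 3 * Real.exp (-((δ + k) / 2 * logBracket x))
      ≤ ((a + c * (12 / δ)) * Real.exp (δ / 12 * logBracket x)) ^ 3 *
        Real.exp (-((δ + k) / 2 * logBracket x)) := by gcongr
    _ = (a + c * (12 / δ)) ^ 3 * (Real.exp (3 * (δ / 12 * logBracket x)) *
        Real.exp (-((δ + k) / 2 * logBracket x))) := by
        rw [mul_pow, ← Real.exp_nat_mul]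
        push_cast
        ring
    _ = _ := by
        rw [← Real.exp_add]
        congr 2
        ring

end Homogenization

/-! ### Partial derivatives in the first variable. -/

section PartialDerivatives

variable (E Y : Type*) [NormedAddCommGroup E] [NormedSpace ℝ E] [NormedAddCommGroup Y]
  [NormedSpace ℝ Y]

/-- Restriction of linear forms on `E × Y` to the first factor. -/
noncomputable def restrictFst : ((E × Y) →L[ℝ] ℝ) →L[ℝ] (E →L[ℝ] ℝ) :=
  (ContinuousLinearMap.compL ℝ E (E × Y) ℝ).flip (ContinuousLinearMap.inl ℝ E Y)

/-- Restriction of bilinear forms on `E × Y` to the first factor. -/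
noncomputable def restrictFst₂ : ((E × Y) →L[ℝ] (E × Y) →L[ℝ] ℝ) →L[ℝ] (E →L[ℝ] E →L[ℝ] ℝ) :=
  ((ContinuousLinearMap.compL ℝ E (E × Y) (E →L[ℝ] ℝ)).flip (ContinuousLinearMap.inl ℝ E Y)).comp
    (ContinuousLinearMap.compL ℝ (E × Y) ((E × Y) →L[ℝ] ℝ) (E →L[ℝ] ℝ) (restrictFst E Y))

variable {E Y} {f : E × Y → ℝ} {θ : E} {y : Y}

theorem hasFDerivAt_partial (hf : ContDiffAt ℝ 2 f (θ, y)) :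
    HasFDerivAt (fun θ => f (θ, y)) (restrictFst E Y (fderiv ℝ f (θ, y))) θ :=
  HasFDerivAt.comp θ (hf.differentiableAt (by norm_num)).hasFDerivAt (hasFDerivAt_prodMk_left θ y)

theorem hasFDerivAt_partial₂ (hf : ContDiffAt ℝ 2 f (θ, y)) :
    HasFDerivAt (fun θ => restrictFst E Y (fderiv ℝ f (θ, y)))
      (restrictFst₂ E Y (fderiv ℝ (fderiv ℝ f) (θ, y))) θ := by
  have h1 : ContDiffAt ℝ 1 (fderiv ℝ f) (θ, y) := hf.fderiv_right (by norm_num)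
  have h2 : HasFDerivAt (fun θ => fderiv ℝ f (θ, y))
      ((fderiv ℝ (fderiv ℝ f) (θ, y)).comp (ContinuousLinearMap.inl ℝ E Y)) θ :=
    HasFDerivAt.comp θ (h1.differentiableAt (by norm_num)).hasFDerivAt
      (hasFDerivAt_prodMk_left θ y)
  exact (restrictFst E Y).hasFDerivAt.comp θ h2

theorem continuousAt_partial (hf : ContDiffAt ℝ 2 f (θ, y)) :
    ContinuousAt (fun p => restrictFst E Y (fderiv ℝ f p)) (θ, y) := by
  have h1 : ContDiffAt ℝ 1 (fderiv ℝ f) (θ, y) := hf.fderiv_right (by norm_num)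
  exact (restrictFst E Y).continuous.continuousAt.comp h1.continuousAt

theorem continuousAt_partial₂ (hf : ContDiffAt ℝ 2 f (θ, y)) :
    ContinuousAt (fun p => restrictFst₂ E Y (fderiv ℝ (fderiv ℝ f) p)) (θ, y) := by
  have h1 : ContDiffAt ℝ 1 (fderiv ℝ f) (θ, y) := hf.fderiv_right (by norm_num)
  have h2 : ContDiffAt ℝ 0 (fderiv ℝ (fderiv ℝ f)) (θ, y) := h1.fderiv_right (by norm_num)
  exact (restrictFst₂ E Y).continuous.continuousAt.comp h2.continuousAt

end PartialDerivatives

/-! ### Score and Hessian, and regularity of the Student family. -/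

section Score

variable {k : ℕ}

/-- The linear form `θ ↦ ν`. -/
noncomputable def tailForm (k : ℕ) : EuclideanSpace ℝ (CoordIdx k) →L[ℝ] ℝ :=
  EuclideanSpace.proj (Sum.inr (Sum.inr ()))

theorem tailForm_apply (θ : EuclideanSpace ℝ (CoordIdx k)) : tailForm k θ = (ofCoords θ).2.2 := rfl

/-- The first derivative of the log-density. -/
noncomputable def scoreForm (θ : EuclideanSpace ℝ (CoordIdx k)) (x : EuclideanSpace ℝ (Fin k)) :
    EuclideanSpace ℝ (CoordIdx k) →L[ℝ] ℝ :=
  restrictFst _ _ (fderiv ℝ homLogDensity (θ, sphereProj x)) - (logBracket x / 2) • tailForm k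

/-- The second derivative of the log-density. -/
noncomputable def hessForm (θ : EuclideanSpace ℝ (CoordIdx k)) (x : EuclideanSpace ℝ (Fin k)) :
    EuclideanSpace ℝ (CoordIdx k) →L[ℝ] EuclideanSpace ℝ (CoordIdx k) →L[ℝ] ℝ :=
  restrictFst₂ _ _ (fderiv ℝ (fderiv ℝ homLogDensity) (θ, sphereProj x))

theorem contDiffAt_homLogDensity_sphereProj {θ : EuclideanSpace ℝ (CoordIdx k)}
    (hθ : θ ∈ coordSpace k) (x : EuclideanSpace ℝ (Fin k)) :
    ContDiffAt ℝ 2 homLogDensity (θ, sphereProj x) :=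
  contDiffAt_homLogDensity hθ (ne_zero_of_mem_sphereSet (sphereProj_mem x))

theorem hasFDerivAt_log_density {θ : EuclideanSpace ℝ (CoordIdx k)} (hθ : θ ∈ coordSpace k)
    (x : EuclideanSpace ℝ (Fin k)) :
    HasFDerivAt (fun θ => Real.log (density (ofCoords θ) x)) (scoreForm θ x) θ := by
  have h1 := hasFDerivAt_partial (contDiffAt_homLogDensity_sphereProj hθ x)
  have h2 : HasFDerivAt (fun θ => (tailForm k θ + k) / 2 * logBracket x)
      ((logBracket x / 2) • tailForm k) θ := by
    have h3 := (((tailForm k).hasFDerivAt (x := θ)).add_const (k : ℝ)).mul_const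
      (logBracket x / 2)
    refine h3.congr_of_eventuallyEq (Eventually.of_forall fun θ => ?_)
    ring
  refine (h1.sub h2).congr_of_eventuallyEq ?_
  filter_upwards [(isOpen_coordSpace k).mem_nhds hθ] with θ' hθ'
  exact log_density hθ' x

/-- The logarithmic part of the score does not depend on the parameter, so it disappears from the
Hessian. -/
theorem hasFDerivAt_scoreForm {θ : EuclideanSpace ℝ (CoordIdx k)} (hθ : θ ∈ coordSpace k)
    (x : EuclideanSpace ℝ (Fin k)) :
    HasFDerivAt (fun θ => scoreForm θ x) (hessForm θ x) θ :=
  (hasFDerivAt_partial₂ (contDiffAt_homLogDensity_sphereProj hθ x)).sub_const _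

theorem continuous_scoreForm {θ : EuclideanSpace ℝ (CoordIdx k)} (hθ : θ ∈ coordSpace k) :
    Continuous (scoreForm θ) := by
  refine Continuous.sub ?_ ((continuous_logBracket.div_const 2).smul continuous_const)
  refine continuous_iff_continuousAt.2 fun x => ?_
  exact ContinuousAt.comp (f := fun x => (θ, sphereProj x))
    (continuousAt_partial (contDiffAt_homLogDensity_sphereProj hθ x))
    (continuous_const.prodMk continuous_sphereProj).continuousAt

theorem continuous_hessForm {θ : EuclideanSpace ℝ (CoordIdx k)} (hθ : θ ∈ coordSpace k) :
    Continuous (hessForm θ) := by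
  refine continuous_iff_continuousAt.2 fun x => ?_
  exact ContinuousAt.comp (f := fun x => (θ, sphereProj x))
    (continuousAt_partial₂ (contDiffAt_homLogDensity_sphereProj hθ x))
    (continuous_const.prodMk continuous_sphereProj).continuousAt

theorem continuous_log_density {θ : EuclideanSpace ℝ (CoordIdx k)} (hθ : θ ∈ coordSpace k) :
    Continuous fun x => Real.log (density (ofCoords θ) x) := by
  simp_rw [log_density hθ]
  refine Continuous.sub ?_ (continuous_const.mul continuous_logBracket)
  refine continuous_iff_continuousAt.2 fun x => ?_
  exact ContinuousAt.comp (f := fun x => (θ, sphereProj x))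
    (contDiffAt_homLogDensity_sphereProj hθ x).continuousAt
    (continuous_const.prodMk continuous_sphereProj).continuousAt

theorem score_eq {V : Triple k} (hV : V ∈ paramSpace k) (x : EuclideanSpace ℝ (Fin k)) :
    score V x = (InnerProductSpace.toDual ℝ _).symm (scoreForm (coords V) x) := by
  rw [score, gradient, (hasFDerivAt_log_density (coords_mem_coordSpace hV) x).fderiv]

theorem inner_score {V : Triple k} (hV : V ∈ paramSpace k) (x : EuclideanSpace ℝ (Fin k))
    (t : EuclideanSpace ℝ (CoordIdx k)) : inner ℝ (score V x) t = scoreForm (coords V) x t := by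
  rw [score_eq hV, InnerProductSpace.toDual_symm_apply]

theorem norm_score {V : Triple k} (hV : V ∈ paramSpace k) (x : EuclideanSpace ℝ (Fin k)) :
    ‖score V x‖ = ‖scoreForm (coords V) x‖ := by
  rw [score_eq hV, LinearIsometryEquiv.norm_map]

theorem continuous_score {V : Triple k} (hV : V ∈ paramSpace k) : Continuous (score V) := by
  have : score V = fun x => (InnerProductSpace.toDual ℝ _).symm (scoreForm (coords V) x) :=
    funext fun x => score_eq hV x
  rw [this]
  exact (LinearIsometryEquiv.continuous _).comp
    (continuous_scoreForm (coords_mem_coordSpace hV))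

theorem exp_log_density {θ : EuclideanSpace ℝ (CoordIdx k)} (hθ : θ ∈ coordSpace k)
    (x : EuclideanSpace ℝ (Fin k)) :
    Real.exp (Real.log (density (ofCoords θ) x)) = density (ofCoords θ) x :=
  Real.exp_log (density_pos hθ x)

theorem law_eq {V : Triple k} (hV : V ∈ paramSpace k) :
    law V = volume.withDensity fun x =>
      ENNReal.ofReal (Real.exp (Real.log (density (ofCoords (coords V)) x))) := by
  simp_rw [exp_log_density (coords_mem_coordSpace hV)]
  rw [ofCoords_coords (isSymm_of_mem_paramSpace hV)]
  rfl

theorem integral_exp_log_density {θ : EuclideanSpace ℝ (CoordIdx k)} (hθ : θ ∈ coordSpace k) :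
    ∫ x, Real.exp (Real.log (density (ofCoords θ) x)) = 1 := by
  rw [integral_eq_lintegral_of_nonneg_ae (Eventually.of_forall fun x => (Real.exp_pos _).le)
    (continuous_log_density hθ).rexp.aestronglyMeasurable]
  simp_rw [exp_log_density hθ]
  rw [lintegral_density hθ, ENNReal.toReal_one]

/-- The Student `t` log-densities form a regular family around every parameter. -/
theorem exists_regularFamily {θ₀ : EuclideanSpace ℝ (CoordIdx k)} (hθ₀ : θ₀ ∈ coordSpace k) :
    ∃ (b w : EuclideanSpace ℝ (Fin k) → ℝ) (r C : ℝ), Metric.ball θ₀ r ⊆ coordSpace k ∧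
      RegularFamily volume (fun θ x => Real.log (density (ofCoords θ) x)) scoreForm hessForm
        b w θ₀ r C := by
  have hν0 : 0 < tailForm k θ₀ := hθ₀.2
  obtain ⟨r₁, hr₁, hball₁⟩ := Metric.isOpen_iff.1 (isOpen_coordSpace k) θ₀ hθ₀
  obtain ⟨r₂, hr₂, hball₂⟩ := Metric.eventually_nhds_iff_ball.1
    ((tailForm k).continuous.continuousAt.eventually (lt_mem_nhds (half_lt_self hν0)))
  -- Halving keeps the closed ball, which is compact, inside the parameter space and inside the
  -- region where the tail exceeds half its central value.
  set r := min r₁ r₂ / 2 with hr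
  have hrpos : 0 < r := half_pos (lt_min hr₁ hr₂)
  have hrlt : r < min r₁ r₂ := half_lt_self (lt_min hr₁ hr₂)
  have hsub : Metric.closedBall θ₀ r ⊆ coordSpace k :=
    (Metric.closedBall_subset_ball (hrlt.trans_le (min_le_left _ _))).trans hball₁
  have htail : ∀ θ ∈ Metric.closedBall θ₀ r, tailForm k θ₀ / 2 ≤ tailForm k θ := fun θ hθ =>
    (hball₂ θ (Metric.closedBall_subset_ball (hrlt.trans_le (min_le_right _ _)) hθ)).le
  have hcd : ∀ p ∈ Metric.closedBall θ₀ r ×ˢ sphereSet k, ContDiffAt ℝ 2 homLogDensity p :=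
    fun p hp => contDiffAt_homLogDensity (hsub hp.1) (ne_zero_of_mem_sphereSet hp.2)
  have hK : IsCompact (Metric.closedBall θ₀ r ×ˢ sphereSet k) :=
    (isCompact_closedBall θ₀ r).prod (isCompact_sphereSet k)
  obtain ⟨M₀, hM₀⟩ := hK.exists_bound_of_continuousOn (f := homLogDensity)
    fun p hp => (hcd p hp).continuousAt.continuousWithinAt
  obtain ⟨M₁, hM₁⟩ := hK.exists_bound_of_continuousOn
    (f := fun p => restrictFst _ _ (fderiv ℝ homLogDensity p))
    fun p hp => (continuousAt_partial (hcd p hp)).continuousWithinAt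
  obtain ⟨M₂, hM₂⟩ := hK.exists_bound_of_continuousOn
    (f := fun p => restrictFst₂ _ _ (fderiv ℝ (fderiv ℝ homLogDensity) p))
    fun p hp => (continuousAt_partial₂ (hcd p hp)).continuousWithinAt
  have hmemK : ∀ θ ∈ Metric.ball θ₀ r, ∀ x,
      (θ, sphereProj x) ∈ Metric.closedBall θ₀ r ×ˢ sphereSet k := fun θ hθ x =>
    ⟨Metric.ball_subset_closedBall hθ, sphereProj_mem x⟩
  have hM₁0 : 0 ≤ M₁ :=
    (norm_nonneg _).trans (hM₁ _ (hmemK θ₀ (Metric.mem_ball_self hrpos) 0))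
  -- The added `1` in the score bound ensures `1 ≤ b`. The density envelope uses half the central
  -- tail weight, the least tail weight guaranteed on the ball.
  refine ⟨fun x => (1 + M₁) + ‖tailForm k‖ / 2 * logBracket x,
    fun x => Real.exp M₀ * Real.exp (-((tailForm k θ₀ / 2 + k) / 2 * logBracket x)), r, M₂,
    Metric.ball_subset_closedBall.trans hsub, ?_⟩
  have hsub' : ∀ θ ∈ Metric.ball θ₀ r, θ ∈ coordSpace k := fun θ hθ =>
    hsub (Metric.ball_subset_closedBall hθ)
  have hmL : Measurable (logBracket (k := k)) := continuous_logBracket.measurable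
  exact
  { pos := hrpos
    hasFDerivAt := fun θ hθ x => hasFDerivAt_log_density (hsub' θ hθ) x
    hasFDerivAt' := fun θ hθ x => hasFDerivAt_scoreForm (hsub' θ hθ) x
    measurable := fun θ hθ => (continuous_log_density (hsub' θ hθ)).measurable
    measurable₁ := fun θ hθ => (continuous_scoreForm (hsub' θ hθ)).stronglyMeasurable
    measurable₂ := fun θ hθ => (continuous_hessForm (hsub' θ hθ)).stronglyMeasurable
    measurable_b := by fun_prop
    measurable_w := by fun_prop
    exp_le := fun θ hθ x => by
      rw [log_density (hsub' θ hθ), ← Real.exp_add, Real.exp_le_exp]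
      have e1 := le_of_abs_le (hM₀ _ (hmemK θ hθ x))
      have e2 := htail θ (Metric.ball_subset_closedBall hθ)
      have e3 := logBracket_nonneg x
      rw [tailForm_apply θ] at e2
      nlinarith
    norm_le₁ := fun θ hθ x => by
      have e1 := hM₁ _ (hmemK θ hθ x)
      refine (norm_sub_le _ _).trans ?_
      rw [norm_smul, Real.norm_of_nonneg (by linarith [logBracket_nonneg x])]
      linarith
    norm_le₂ := fun θ hθ x => hM₂ _ (hmemK θ hθ x)
    one_le := fun x => by
      have := mul_nonneg (div_nonneg (norm_nonneg (tailForm k)) zero_le_two) (logBracket_nonneg x)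
      linarith
    integrable := by
      have := (integrable_add_mul_logBracket_pow (k := k) (1 + M₁) (‖tailForm k‖ / 2)
        (by positivity) (by positivity) (half_pos hν0)).const_mul (Real.exp M₀)
      refine this.congr (Eventually.of_forall fun x => ?_)
      ring
    equicontinuous := fun ε hε => by
      -- Compactness of the sphere upgrades joint continuity to continuity in the parameter uniform
      -- over all observations.
      have h1 : ∀ᶠ θ in 𝓝 θ₀, ∀ y ∈ sphereSet k,
          ‖restrictFst₂ _ _ (fderiv ℝ (fderiv ℝ homLogDensity) (θ, y)) -
            restrictFst₂ _ _ (fderiv ℝ (fderiv ℝ homLogDensity) (θ₀, y))‖ < ε := by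
        refine (isCompact_sphereSet k).eventually_forall_of_forall_eventually fun y hy => ?_
        have hc := continuousAt_partial₂ (hcd (θ₀, y) ⟨Metric.mem_closedBall_self hrpos.le, hy⟩)
        have hc' : ContinuousAt (fun p : EuclideanSpace ℝ (CoordIdx k) ×
            (ℝ × EuclideanSpace ℝ (Fin k)) =>
            restrictFst₂ _ _ (fderiv ℝ (fderiv ℝ homLogDensity) (θ₀, p.2))) (θ₀, y) :=
          ContinuousAt.comp (x := (θ₀, y))
            (g := fun p => restrictFst₂ _ _ (fderiv ℝ (fderiv ℝ homLogDensity) p))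
            (f := fun p : EuclideanSpace ℝ (CoordIdx k) ×
              (ℝ × EuclideanSpace ℝ (Fin k)) => (θ₀, p.2)) hc (by fun_prop)
        have := (hc.sub hc').norm
        exact this.eventually (gt_mem_nhds (by simpa using hε))
      filter_upwards [h1] with θ hθ x using (hθ _ (sphereProj_mem x)).le
    integral_eq_one := fun θ hθ => integral_exp_log_density (hsub' θ hθ) }

end Score

/-! ### No direction annihilates the score. -/

section Nondegeneracy

variable {k : ℕ}

theorem exists_lt_logBracket (hk : 0 < k) (c : ℝ) :
    ∃ x : EuclideanSpace ℝ (Fin k), c < logBracket x := by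
  refine ⟨EuclideanSpace.single ⟨0, hk⟩ (Real.exp (|c| + 1)), ?_⟩
  rw [logBracket, PiLp.norm_single, Real.norm_of_nonneg (Real.exp_pos _).le]
  calc c ≤ |c| := le_abs_self c
    _ < |c| + 1 := lt_add_one _
    _ = Real.log (Real.exp (|c| + 1)) := (Real.log_exp _).symm
    _ ≤ _ := Real.log_le_log (Real.exp_pos _) (by nlinarith [sq_nonneg (Real.exp (|c| + 1) - 1)])

/-- A direction along which the log-density is stationary at every observation has vanishing tail
component, since that component multiplies an unbounded function of the observation. -/
theorem tailForm_eq_zero_of_scoreForm (hk : 0 < k) {θ : EuclideanSpace ℝ (CoordIdx k)}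
    (hθ : θ ∈ coordSpace k) {v : EuclideanSpace ℝ (CoordIdx k)}
    (hv : ∀ x, scoreForm θ x v = 0) : tailForm k v = 0 := by
  obtain ⟨M, hM⟩ := (isCompact_sphereSet k).exists_bound_of_continuousOn
    (f := fun y => restrictFst _ _ (fderiv ℝ homLogDensity (θ, y)) v) (fun y hy => by
      have h1 := continuousAt_partial
        (contDiffAt_homLogDensity (n := 2) (p := (θ, y)) hθ (ne_zero_of_mem_sphereSet hy))
      have h2 : ContinuousAt (fun y => restrictFst _ _ (fderiv ℝ homLogDensity (θ, y))) y :=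
        ContinuousAt.comp (x := y)
          (g := fun p => restrictFst _ _ (fderiv ℝ homLogDensity p))
          (f := fun y : ℝ × EuclideanSpace ℝ (Fin k) => (θ, y)) h1 (by fun_prop)
      exact (h2.clm_apply continuousAt_const).continuousWithinAt)
  by_contra hne
  -- The bounded part of the score forces `logBracket x / 2 * |tailForm k v| ≤ M`, which this `x`
  -- violates.
  obtain ⟨x, hx⟩ := exists_lt_logBracket hk (2 * M / |tailForm k v|)
  have h1 := hv x
  simp only [scoreForm, sub_apply, smul_apply, smul_eq_mul] at h1
  have h2 := hM _ (sphereProj_mem x)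
  rw [sub_eq_zero.1 h1, norm_mul, Real.norm_eq_abs, Real.norm_eq_abs,
    abs_of_nonneg (by linarith [logBracket_nonneg x])] at h2
  rw [div_lt_iff₀ (abs_pos.2 hne)] at hx
  linarith

theorem ofCoords_add_smul (θ v : EuclideanSpace ℝ (CoordIdx k)) (t : ℝ) :
    ofCoords (θ + t • v) = ofCoords θ + t • ofCoords v := by
  refine Prod.ext ?_ (Prod.ext ?_ ?_)
  · ext i
    simp [ofCoords]
  · ext i j
    simp [ofCoords, unvech]
  · simp [ofCoords]

theorem ofCoords_injective : Function.Injective (ofCoords (k := k)) := by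
  intro θ θ' h
  have h1 := congrArg (fun V : Triple k => coords V) h
  have h2 : ∀ θ : EuclideanSpace ℝ (CoordIdx k), coords (ofCoords θ) = θ := fun θ => by
    ext i
    rcases i with i | ⟨⟨i, j⟩, hij⟩ | i
    · rfl
    · simp only at hij
      simp [coords, vech, ofCoords, unvech, hij]
    · rfl
  simpa [h2] using h1

/-- Polarization at pairs of basis vectors. -/
theorem eq_zero_of_isSymm_of_dotProduct_mulVec {T : Matrix (Fin k) (Fin k) ℝ} (hT : T.IsSymm)
    (h : ∀ w : Fin k → ℝ, w ⬝ᵥ (T *ᵥ w) = 0) : T = 0 := by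
  have h1 : ∀ i j, T i j = 0 := fun i j => by
    have e1 := h (Pi.single i 1)
    have e2 := h (Pi.single j 1)
    have e3 := h (Pi.single i 1 + Pi.single j 1)
    simp only [Matrix.mulVec_add, dotProduct_add, add_dotProduct] at e3
    rw [e1, e2] at e3
    simp only [single_dotProduct, Matrix.mulVec_single, one_mul,
      MulOpposite.op_one, one_smul, Matrix.col_apply] at e3
    have := hT.apply i j
    linarith
  ext i j
  exact h1 i j

/-- Differentiability comes from Cramer's rule; the value then follows by differentiating `(S + t •
T)⁻¹ * (S + t • T) = 1`. -/
theorem hasDerivAt_inv_add_smul_apply {S T : Matrix (Fin k) (Fin k) ℝ} (hS : S.det ≠ 0)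
    (i j : Fin k) :
    HasDerivAt (fun t : ℝ => (S + t • T)⁻¹ i j) (-(S⁻¹ * T * S⁻¹) i j) 0 := by
  have hcd : ∀ i j, ContDiffAt ℝ 1 (fun t : ℝ => (S + t • T) i j) 0 := fun i j => by
    simp only [Matrix.add_apply, Matrix.smul_apply, smul_eq_mul]
    fun_prop
  have hinv : ∀ i j, DifferentiableAt ℝ (fun t : ℝ => (S + t • T)⁻¹ i j) 0 := fun i j =>
    (contDiffAt_inv_apply hcd (by simpa using hS) i j).differentiableAt (by norm_num)
  set N : Matrix (Fin k) (Fin k) ℝ :=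
    Matrix.of fun i j => deriv (fun t : ℝ => (S + t • T)⁻¹ i j) 0 with hN
  have hder : ∀ i j, HasDerivAt (fun t : ℝ => (S + t • T)⁻¹ i j) (N i j) 0 := fun i j =>
    (hinv i j).hasDerivAt
  have hlin : ∀ i j, HasDerivAt (fun t : ℝ => (S + t • T) i j) (T i j) 0 := fun i j => by
    simp only [Matrix.add_apply, Matrix.smul_apply, smul_eq_mul]
    simpa using ((hasDerivAt_id (0 : ℝ)).mul_const (T i j)).const_add (S i j)
  have hdet : ∀ᶠ t : ℝ in 𝓝 0, (S + t • T).det ≠ 0 := by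
    have := (contDiffAt_det hcd).continuousAt
    exact this.eventually_ne (by simpa using hS)
  have hprod : N * S + S⁻¹ * T = 0 := by
    ext a c
    have h1 : HasDerivAt (fun t : ℝ => ∑ b, (S + t • T)⁻¹ a b * (S + t • T) b c)
        (∑ b, (N a b * (S + (0 : ℝ) • T) b c + (S + (0 : ℝ) • T)⁻¹ a b * T b c)) 0 :=
      HasDerivAt.fun_sum fun b _ => (hder a b).mul (hlin b c)
    have h2 : HasDerivAt (fun t : ℝ => ∑ b, (S + t • T)⁻¹ a b * (S + t • T) b c) 0 0 := by
      refine (hasDerivAt_const (0 : ℝ) ((1 : Matrix (Fin k) (Fin k) ℝ) a c)).congr_of_eventuallyEq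
        ?_
      filter_upwards [hdet] with t ht
      rw [← Matrix.mul_apply, Matrix.nonsing_inv_mul _ (isUnit_iff_ne_zero.2 ht)]
    have h3 := h1.unique h2
    simpa [Matrix.mul_apply, Finset.sum_add_distrib] using h3
  have hNeq : N = -(S⁻¹ * T * S⁻¹) := by
    have hu := isUnit_iff_ne_zero.2 hS
    calc N = N * S * S⁻¹ := by rw [Matrix.mul_assoc, Matrix.mul_nonsing_inv _ hu, Matrix.mul_one]
      _ = _ := by rw [eq_neg_of_add_eq_zero_left hprod, Matrix.neg_mul]
  have := hder i j
  rwa [hNeq] at this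

theorem hasDerivAt_mahalanobisSq (μ m z : EuclideanSpace ℝ (Fin k))
    {S T : Matrix (Fin k) (Fin k) ℝ} (hS : S.PosDef) :
    HasDerivAt (fun t : ℝ => mahalanobisSq (μ + t • m) (S + t • T) (μ + z))
      (-2 * (m.ofLp ⬝ᵥ (S⁻¹ *ᵥ z.ofLp)) - z.ofLp ⬝ᵥ ((S⁻¹ * T * S⁻¹) *ᵥ z.ofLp)) 0 := by
  have hz : ∀ i, HasDerivAt (fun t : ℝ => (μ + z - (μ + t • m)).ofLp i) (-m.ofLp i) 0 :=
    fun i => by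
      simp only [WithLp.ofLp_sub, WithLp.ofLp_add, WithLp.ofLp_smul, Pi.sub_apply, Pi.add_apply,
        Pi.smul_apply, smul_eq_mul]
      simpa using (((hasDerivAt_id (0 : ℝ)).mul_const (m.ofLp i)).const_add (μ.ofLp i)).const_sub
        (μ.ofLp i + z.ofLp i)
  have h1 : HasDerivAt (fun t : ℝ => mahalanobisSq (μ + t • m) (S + t • T) (μ + z))
      (∑ i, (-m.ofLp i * ∑ j, S⁻¹ i j * z.ofLp j +
        z.ofLp i * ∑ j, (-(S⁻¹ * T * S⁻¹) i j * z.ofLp j + S⁻¹ i j * -m.ofLp j))) 0 := by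
    have h := HasDerivAt.fun_sum (u := Finset.univ) fun i _ => (hz i).mul
      (HasDerivAt.fun_sum (u := Finset.univ) fun j _ =>
        (hasDerivAt_inv_add_smul_apply (T := T) hS.det_pos.ne' i j).mul (hz j))
    simpa [mahalanobisSq, dotProduct, Matrix.mulVec] using h
  convert! h1 using 1
  have hsym : ∀ i j, S⁻¹ i j = S⁻¹ j i := fun i j => by
    have := hS.inv.isHermitian.apply i j
    simpa using this.symm
  have e1 : z.ofLp ⬝ᵥ (S⁻¹ *ᵥ m.ofLp) = m.ofLp ⬝ᵥ (S⁻¹ *ᵥ z.ofLp) := by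
    simp only [dotProduct, Matrix.mulVec, Finset.mul_sum]
    rw [Finset.sum_comm]
    refine Finset.sum_congr rfl fun i _ => Finset.sum_congr rfl fun j _ => ?_
    rw [hsym i j]
    ring
  have e2 : (∑ i, (-m.ofLp i * ∑ j, S⁻¹ i j * z.ofLp j +
        z.ofLp i * ∑ j, (-(S⁻¹ * T * S⁻¹) i j * z.ofLp j + S⁻¹ i j * -m.ofLp j))) =
      -(m.ofLp ⬝ᵥ (S⁻¹ *ᵥ z.ofLp)) - z.ofLp ⬝ᵥ ((S⁻¹ * T * S⁻¹) *ᵥ z.ofLp) -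
        z.ofLp ⬝ᵥ (S⁻¹ *ᵥ m.ofLp) := by
    simp only [dotProduct, Matrix.mulVec, ← Finset.sum_sub_distrib, ← Finset.sum_neg_distrib]
    refine Finset.sum_congr rfl fun i _ => ?_
    simp only [Finset.sum_add_distrib, neg_mul, mul_neg, Finset.sum_neg_distrib]
    ring
  rw [e2, e1]
  ring

/-- The score form is non-degenerate: no direction is annihilated at every observation. -/
theorem eq_zero_of_scoreForm (hk : 0 < k) {θ : EuclideanSpace ℝ (CoordIdx k)}
    (hθ : θ ∈ coordSpace k) {v : EuclideanSpace ℝ (CoordIdx k)}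
    (hv : ∀ x, scoreForm θ x v = 0) : v = 0 := by
  have hr : (ofCoords v).2.2 = 0 := tailForm_eq_zero_of_scoreForm hk hθ hv
  have hT : (ofCoords v).2.1.IsSymm :=
    unvech_isSymm fun p => v (Sum.inr (Sum.inl p))
  have hS : (ofCoords θ).2.1.PosDef := hθ.1
  have hν : 0 < (ofCoords θ).2.2 := hθ.2
  -- With zero tail component, the line in direction `v` moves only location and scatter.
  have hpath : ∀ t : ℝ, ofCoords (θ + t • v) = ((ofCoords θ).1 + t • (ofCoords v).1,
      (ofCoords θ).2.1 + t • (ofCoords v).2.1, (ofCoords θ).2.2) := fun t => by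
    rw [ofCoords_add_smul]
    refine Prod.ext rfl (Prod.ext rfl ?_)
    simp [hr]
  generalize (ofCoords θ).1 = μ at *
  generalize (ofCoords θ).2.1 = S at *
  generalize (ofCoords θ).2.2 = ν at *
  generalize hm : (ofCoords v).1 = m at *
  generalize hTv : (ofCoords v).2.1 = T at *
  have hline : HasDerivAt (fun t : ℝ => θ + t • v) v 0 := by
    simpa using ((hasDerivAt_id (0 : ℝ)).smul_const v).const_add θ
  have hev : ∀ᶠ t : ℝ in 𝓝 0, θ + t • v ∈ coordSpace k := by
    refine hline.continuousAt.eventually ((isOpen_coordSpace k).mem_nhds ?_)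
    simpa using hθ
  have hcd : ∀ i j, ContDiffAt ℝ 1 (fun t : ℝ => (S + t • T) i j) 0 := fun i j => by
    simp only [Matrix.add_apply, Matrix.smul_apply, smul_eq_mul]
    fun_prop
  have hdetd : DifferentiableAt ℝ (fun t : ℝ => Real.log (S + t • T).det) 0 :=
    ((contDiffAt_det hcd).log (by simpa using hS.det_pos.ne')).differentiableAt (by norm_num)
  -- The value of `d` need not be computed: the observation at the centre `z = 0` will force it to
  -- vanish.
  set d := deriv (fun t : ℝ => Real.log (S + t • T).det) 0
  set q : EuclideanSpace ℝ (Fin k) → ℝ := fun z =>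
    -2 * (m.ofLp ⬝ᵥ (S⁻¹ *ᵥ z.ofLp)) - z.ofLp ⬝ᵥ ((S⁻¹ * T * S⁻¹) *ᵥ z.ofLp) with hq
  have key : ∀ z, 1 / 2 * d +
      (ν + k) / 2 * (q z / ν / (1 + mahalanobisSq μ S (μ + z) / ν)) = 0 := fun z => by
    have hQ0 := mahalanobisSq_nonneg hS μ (μ + z)
    have h1 : HasDerivAt (fun t : ℝ => Real.log (density (ofCoords (θ + t • v)) (μ + z))) 0 0 := by
      have h := hasFDerivAt_log_density hθ (μ + z)
      rw [show θ = θ + (0 : ℝ) • v by simp] at h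
      have h' := h.comp_hasDerivAt (0 : ℝ) hline
      simp only [zero_smul, add_zero, hv] at h'
      exact h'
    have h2 : HasDerivAt (fun t : ℝ => Real.log (1 + mahalanobisSq (μ + t • m) (S + t • T)
        (μ + z) / ν)) (q z / ν / (1 + mahalanobisSq μ S (μ + z) / ν)) 0 := by
      have := (((hasDerivAt_mahalanobisSq μ m z (T := T) hS).div_const ν).const_add 1).log
        (by simp only [zero_smul, add_zero]; positivity)
      simpa only [zero_smul, add_zero] using this
    have h3 : HasDerivAt (fun t : ℝ => Real.log (normConst k ν) -
        (1 / 2 * Real.log (S + t • T).det + (ν + k) / 2 *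
          Real.log (1 + mahalanobisSq (μ + t • m) (S + t • T) (μ + z) / ν)))
        (-(1 / 2 * d + (ν + k) / 2 * (q z / ν / (1 + mahalanobisSq μ S (μ + z) / ν)))) 0 :=
      ((hdetd.hasDerivAt.const_mul (1 / 2)).add (h2.const_mul ((ν + k) / 2))).const_sub _
    have h4 := h3.congr_of_eventuallyEq (f₁ := fun t : ℝ =>
        Real.log (density (ofCoords (θ + t • v)) (μ + z))) (by
      filter_upwards [hev] with t ht
      have ht' : ofCoords (θ + t • v) ∈ paramSpace k := ht
      rw [hpath t] at ht' ⊢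
      have e1 : 0 < (S + t • T).det := ht'.1.det_pos
      have e2 := mahalanobisSq_nonneg ht'.1 (μ + t • m) (μ + z)
      simp only at e2
      have e3 := normConst_pos k hν
      have e4 : 0 < 1 + mahalanobisSq (μ + t • m) (S + t • T) (μ + z) / ν := by positivity
      simp only [density]
      rw [Real.log_mul (by positivity) (by positivity),
        Real.log_mul (by positivity) (by positivity), Real.log_rpow e1, Real.log_rpow e4]
      ring)
    linarith [h4.unique h1]
  have hd : d = 0 := by
    have := key 0
    simpa [hq] using this
  have hqz : ∀ z, q z = 0 := fun z => by
    have h := key z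
    have hQ0 := mahalanobisSq_nonneg hS μ (μ + z)
    have e1 : 0 < 1 + mahalanobisSq μ S (μ + z) / ν := by positivity
    have e2 : (0 : ℝ) < (ν + k) / 2 := by positivity
    rw [hd, mul_zero, zero_add, mul_eq_zero, or_iff_right e2.ne', div_eq_zero_iff,
      or_iff_left e1.ne', div_eq_zero_iff, or_iff_left hν.ne'] at h
    exact h
  -- The odd part of `q` is linear; comparing `z = m` with `z = -m` gives `m' S⁻¹ m = 0`.
  have hm0 : m = 0 := by
    by_contra hne
    have h1 := hqz m
    have h2 := hqz (-m)
    simp only [hq, WithLp.ofLp_neg, Matrix.mulVec_neg, dotProduct_neg, neg_dotProduct,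
      neg_neg] at h1 h2
    have h3 := hS.inv.dotProduct_mulVec_pos (x := m.ofLp)
      (fun h => hne ((WithLp.ofLp_injective 2) (by simpa using h)))
    simp only [star_trivial] at h3
    linarith
  have hT0 : T = 0 := by
    refine eq_zero_of_isSymm_of_dotProduct_mulVec hT fun w => ?_
    -- Taking `z = S w` cancels both inverses in `S⁻¹ T S⁻¹`.
    have h := hqz (WithLp.toLp 2 (S *ᵥ w))
    have hu : IsUnit S.det := isUnit_iff_ne_zero.2 hS.det_pos.ne'
    have hsym : Sᵀ = S := by simpa using hS.isHermitian.eq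
    simp only [hq, hm0, WithLp.ofLp_zero, zero_dotProduct, mul_zero, zero_sub, neg_eq_zero,
      Matrix.mulVec_mulVec] at h
    have e : S *ᵥ w = w ᵥ* S := by rw [← Matrix.vecMul_transpose, hsym]
    rwa [Matrix.mul_assoc (S⁻¹ * T), Matrix.nonsing_inv_mul _ hu, Matrix.mul_one,
      Matrix.dotProduct_mulVec, e, Matrix.vecMul_vecMul, ← Matrix.mul_assoc,
      Matrix.mul_nonsing_inv _ hu, Matrix.one_mul, ← Matrix.dotProduct_mulVec] at h
  apply ofCoords_injective
  refine Prod.ext ?_ (Prod.ext ?_ ?_)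
  · rw [hm, hm0]
    ext i
    simp [ofCoords]
  · rw [hTv, hT0]
    ext i j
    simp [ofCoords, unvech]
  · rw [hr]
    simp [ofCoords]

end Nondegeneracy

/-! ### Fisher information. -/

section FisherInformation

variable {k : ℕ}

theorem integrable_law_of_norm_le {V : Triple k} (hV : V ∈ paramSpace k)
    {g : EuclideanSpace ℝ (Fin k) → ℝ} (hg : Continuous g) {K : ℝ} {j : ℕ} (hj : j ≤ 3)
    (hb : ∀ x, ‖g x‖ ≤ K * ‖score V x‖ ^ j) : Integrable g (law V) := by
  have hθ := coords_mem_coordSpace hV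
  obtain ⟨b, w, r, C, -, h⟩ := exists_regularFamily hθ
  have hθb := Metric.mem_ball_self h.pos (x := coords V)
  rw [law_eq hV, integrable_withDensity_exp_iff _ (h.measurable _ hθb)]
  refine h.integrable_of_norm_le hθb hg.aestronglyMeasurable (K := |K|) hj fun x => ?_
  calc ‖g x‖ ≤ K * ‖score V x‖ ^ j := hb x
    _ ≤ |K| * ‖score V x‖ ^ j := by gcongr; exact le_abs_self K
    _ ≤ |K| * b x ^ j := by
      have := h.norm_le₁ _ hθb x
      rw [← norm_score hV] at this
      gcongr

theorem memLp_score {V : Triple k} (hV : V ∈ paramSpace k) (i : CoordIdx k) :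
    MemLp (fun x => score V x i) 2 (law V) := by
  have hc : Continuous fun x => score V x i := by
    have := continuous_score hV
    fun_prop
  rw [memLp_two_iff_integrable_sq hc.aestronglyMeasurable]
  refine integrable_law_of_norm_le hV (hc.pow 2) (K := 1) (j := 2) (by norm_num)
    fun x => ?_
  rw [norm_pow, one_mul]
  gcongr
  exact PiLp.norm_apply_le _ i

theorem integral_law {V : Triple k} (hV : V ∈ paramSpace k) (g : EuclideanSpace ℝ (Fin k) → ℝ) :
    ∫ x, g x ∂law V =
      ∫ x, Real.exp (Real.log (density (ofCoords (coords V)) x)) * g x := by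
  rw [law_eq hV, integral_withDensity_exp _
    (continuous_log_density (coords_mem_coordSpace hV)).measurable]
  rfl

theorem integral_inner_score {V : Triple k} (hV : V ∈ paramSpace k)
    (t : EuclideanSpace ℝ (CoordIdx k)) : ∫ x, inner ℝ (score V x) t ∂law V = 0 := by
  obtain ⟨b, w, r, C, -, h⟩ := exists_regularFamily (coords_mem_coordSpace hV)
  have hθb := Metric.mem_ball_self h.pos (x := coords V)
  have hi := h.integrable_of_norm_le hθb (h.measurable₁ _ hθb).aestronglyMeasurable
    (K := 1) (j := 1) (by norm_num) (by simpa using h.norm_le₁ _ hθb)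
  have h1 := congrArg (fun L : EuclideanSpace ℝ (CoordIdx k) →L[ℝ] ℝ => L t)
    (h.integral_score hθb)
  simp only [zero_apply] at h1
  rw [ContinuousLinearMap.integral_apply hi] at h1
  rw [integral_law hV]
  simpa [inner_score hV] using h1

theorem fisherInfo_apply {V : Triple k} (hV : V ∈ paramSpace k) (i j : CoordIdx k) :
    fisherInfo V i j = ∫ x, score V x i * score V x j ∂law V := by
  have h0 : ∀ i, ∫ x, score V x i ∂law V = 0 := fun i => by
    have := integral_inner_score hV (EuclideanSpace.single i 1)
    simpa [EuclideanSpace.inner_single_right] using this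
  simp [fisherInfo, covariance, h0]

theorem dotProduct_fisherInfo_mulVec {V : Triple k} (hV : V ∈ paramSpace k)
    (t : EuclideanSpace ℝ (CoordIdx k)) :
    t.ofLp ⬝ᵥ (fisherInfo V *ᵥ t.ofLp) = ∫ x, (inner ℝ (score V x) t) ^ 2 ∂law V := by
  have hi : ∀ i j, Integrable (fun x => score V x i * score V x j) (law V) := fun i j =>
    (memLp_score hV i).integrable_mul (memLp_score hV j)
  have h1 : ∀ x, (inner ℝ (score V x) t) ^ 2 =
      ∑ i, ∑ j, t i * t j * (score V x i * score V x j) := fun x => by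
    rw [sq, PiLp.inner_apply, Finset.sum_mul_sum]
    refine Finset.sum_congr rfl fun i _ => Finset.sum_congr rfl fun j _ => ?_
    simp only [RCLike.inner_apply, conj_trivial]
    ring
  simp_rw [h1]
  rw [integral_finsetSum _ fun i _ => integrable_finsetSum _ fun j _ => (hi i j).const_mul _]
  refine Finset.sum_congr rfl fun i _ => ?_
  rw [integral_finsetSum _ fun j _ => (hi i j).const_mul _, Matrix.mulVec, dotProduct,
    Finset.mul_sum]
  refine Finset.sum_congr rfl fun j _ => ?_
  rw [integral_const_mul, fisherInfo_apply hV]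
  ring

theorem fisherInfo_posDef (hk : 0 < k) {V : Triple k} (hV : V ∈ paramSpace k) :
    (fisherInfo V).PosDef := by
  refine Matrix.PosDef.of_dotProduct_mulVec_pos ?_ fun t ht => ?_
  · ext i j
    simp only [Matrix.conjTranspose_apply, star_trivial, fisherInfo_apply hV, mul_comm]
  · have h1 := dotProduct_fisherInfo_mulVec hV (WithLp.toLp 2 t)
    simp only at h1
    rw [star_trivial, h1]
    have hc : Continuous fun x => (inner ℝ (score V x) (WithLp.toLp 2 t)) ^ 2 := by
      have := continuous_score hV
      fun_prop
    have hi : Integrable (fun x => (inner ℝ (score V x) (WithLp.toLp 2 t)) ^ 2) (law V) := by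
      refine integrable_law_of_norm_le hV hc (K := ‖WithLp.toLp 2 t‖ ^ 2) (j := 2)
        (by norm_num) fun x => ?_
      rw [norm_pow, ← mul_pow, mul_comm]
      gcongr
      exact norm_inner_le_norm _ _
    refine lt_of_le_of_ne (integral_nonneg fun x => sq_nonneg _) fun h0 => ?_
    have h2 := (integral_eq_zero_iff_of_nonneg (fun x => sq_nonneg _) hi).1 h0.symm
    -- The density is positive everywhere, so a score component vanishing almost surely vanishes
    -- Lebesgue-almost everywhere, and by continuity everywhere.
    have hac : (volume : Measure (EuclideanSpace ℝ (Fin k))) ≪ law V := by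
      have hm := (continuous_log_density (coords_mem_coordSpace hV)).measurable
      rw [law_eq hV]
      refine withDensity_absolutelyContinuous' hm.exp.ennreal_ofReal.aemeasurable
        (Eventually.of_forall fun x => ?_)
      simpa using Real.exp_pos _
    have h3 := (hc.ae_eq_iff_eq volume continuous_const).1 (hac.ae_le h2)
    have h4 := eq_zero_of_scoreForm hk (coords_mem_coordSpace hV) (v := WithLp.toLp 2 t)
      fun x => by
        have := congrFun h3 x
        rw [inner_score hV] at this
        exact pow_eq_zero_iff (two_ne_zero) |>.1 this
    exact ht (by simpa using h4)

end FisherInformation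

/-! ### Limits along sequences of parameters. -/

section Sequences

variable {k : ℕ}

/-- Asymptotic normality of the central sequence along a convergent sequence of parameters. -/
theorem tendstoInDistribution_centralSeq (hk : 0 < k) {V : Triple k} (hV : V ∈ paramSpace k)
    {Vn : ℕ → Triple k} (hVn : ∀ n, Vn n ∈ paramSpace k)
    (hlim : Tendsto (fun n => coords (Vn n)) atTop (𝓝 (coords V)))
    [∀ n, IsProbabilityMeasure (law (Vn n))] :
    TendstoInDistribution
      (fun n (x : Fin n → EuclideanSpace ℝ (Fin k)) => (√(n : ℝ))⁻¹ • ∑ i, score (Vn n) (x i))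
      atTop id (fun n => Measure.pi fun _ : Fin n => law (Vn n))
      (multivariateGaussian 0 (fisherInfo V)) := by
  obtain ⟨b, w, r, C, -, h⟩ := exists_regularFamily (coords_mem_coordSpace hV)
  have hev := hlim (Metric.ball_mem_nhds _ h.pos)
  -- The envelope integral bounds the third moments uniformly once the parameters enter the ball.
  refine tendstoInDistribution_inv_sqrt_smul_sum (C := ∫ x, b x ^ 3 * w x) _
    (fun n => (continuous_score (hVn n)).measurable) (fisherInfo_posDef hk hV).posSemidef ?_
    (Eventually.of_forall fun n t => integral_inner_score (hVn n) t) fun t => ?_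
  · filter_upwards [hev] with n hn
    have hc : Continuous fun x => ‖score (Vn n) x‖ ^ 3 := (continuous_score (hVn n)).norm.pow 3
    have hi : Integrable (fun x => ‖score (Vn n) x‖ ^ 3) (law (Vn n)) :=
      integrable_law_of_norm_le (hVn n) hc (K := 1) (j := 3) le_rfl fun x => by simp
    refine ⟨hi, ?_⟩
    rw [integral_law (hVn n)]
    refine integral_mono_of_nonneg (Eventually.of_forall fun x => ?_) h.integrable
      (Eventually.of_forall fun x => ?_)
    · have := Real.exp_pos (Real.log (density (ofCoords (coords (Vn n))) x))
      simp only [Pi.zero_apply]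
      positivity
    · have e1 := h.exp_le _ hn x
      have e2 := h.norm_le₁ _ hn x
      rw [← norm_score (hVn n)] at e2
      have e3 : 0 ≤ b x := zero_le_one.trans (h.one_le x)
      simp only
      rw [mul_comm]
      gcongr
  · rw [dotProduct_fisherInfo_mulVec hV, integral_law hV]
    have h1 := (h.tendsto_integral (g := fun θ x => (scoreForm θ x t) ^ 2) (fun θ hθ => ?_)
      (fun x => ?_) (K := ‖t‖ ^ 2) (j := 2) (by norm_num) (fun θ hθ x => ?_)).comp hlim
    · simp only [inner_score hV]
      refine h1.congr fun n => ?_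
      rw [integral_law (hVn n)]
      simp [inner_score (hVn n)]
    · exact ((h.measurable₁ θ hθ).aestronglyMeasurable.apply_continuousLinearMap t).pow 2
    · have := (h.hasFDerivAt' _ (Metric.mem_ball_self h.pos) x).continuousAt
      exact (this.clm_apply continuousAt_const).pow 2
    · rw [norm_pow, ← mul_pow, mul_comm]
      gcongr
      exact ((scoreForm θ x).le_opNorm t).trans (by gcongr; exact h.norm_le₁ θ hθ x)

/-- Positivity of both densities lets the quotient be written as an exponential, the form required
by `llr_pi_withDensity`. -/
theorem law_eq_withDensity {V W : Triple k} (hV : V ∈ paramSpace k) (hW : W ∈ paramSpace k) :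
    law W = (law V).withDensity fun x => ENNReal.ofReal (Real.exp
      (Real.log (density (ofCoords (coords W)) x) -
        Real.log (density (ofCoords (coords V)) x))) := by
  have hmV := (continuous_log_density (coords_mem_coordSpace hV)).measurable
  have hmW := (continuous_log_density (coords_mem_coordSpace hW)).measurable
  rw [law_eq hV, law_eq hW, ← withDensity_mul _ (by fun_prop) (by fun_prop)]
  congr 1
  ext x
  rw [Pi.mul_apply, ← ENNReal.ofReal_mul (Real.exp_pos _).le, ← Real.exp_add]
  congr 2
  ring

theorem lawN_absolutelyContinuous {V W : Triple k} (hV : V ∈ paramSpace k)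
    (hW : W ∈ paramSpace k) (n : ℕ) : lawN n W ≪ lawN n V := by
  have hmV := (continuous_log_density (coords_mem_coordSpace hV)).measurable
  have hmW := (continuous_log_density (coords_mem_coordSpace hW)).measurable
  have := isProbabilityMeasure_law hV
  have hpW := isProbabilityMeasure_law hW
  rw [law_eq_withDensity hV hW] at hpW
  rw [lawN, lawN, law_eq_withDensity hV hW, pi_withDensity _ (by fun_prop)]
  exact withDensity_absolutelyContinuous _ _

theorem llr_lawN {V W : Triple k} (hV : V ∈ paramSpace k) (hW : W ∈ paramSpace k) (n : ℕ) :
    llr (lawN n W) (lawN n V) =ᵐ[lawN n V] fun x => ∑ i,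
      (Real.log (density (ofCoords (coords W)) (x i)) -
        Real.log (density (ofCoords (coords V)) (x i))) := by
  have hmV := (continuous_log_density (coords_mem_coordSpace hV)).measurable
  have hmW := (continuous_log_density (coords_mem_coordSpace hW)).measurable
  have := isProbabilityMeasure_law hV
  have hpW := isProbabilityMeasure_law hW
  rw [law_eq_withDensity hV hW] at hpW
  have h := llr_pi_withDensity (n := n) (law V)
    (u := fun x => Real.log (density (ofCoords (coords W)) x) -
      Real.log (density (ofCoords (coords V)) x)) (hmW.sub hmV)
  rw [← law_eq_withDensity hV hW] at h
  exact h

theorem dotProduct_centralSeq {V : Triple k} (hV : V ∈ paramSpace k) (n : ℕ)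
    (x : Fin n → EuclideanSpace ℝ (Fin k)) (t : EuclideanSpace ℝ (CoordIdx k)) :
    t.ofLp ⬝ᵥ (centralSeq n V x).ofLp = (√(n : ℝ))⁻¹ * ∑ i, scoreForm (coords V) (x i) t := by
  have h1 : t.ofLp ⬝ᵥ (centralSeq n V x).ofLp = inner ℝ (centralSeq n V x) t := by
    simp [PiLp.inner_apply, dotProduct]
  rw [h1, centralSeq, real_inner_smul_left, sum_inner]
  simp_rw [inner_score hV]

/-- Quadratic expansion of the log-likelihood ratio along a convergent sequence of parameters. -/
theorem isLittleOP_llr_sub {V : Triple k} (hV : V ∈ paramSpace k)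
    {Vn τ : ℕ → Triple k} (hVn : ∀ n, Vn n ∈ paramSpace k)
    (hlim : Tendsto (fun n => coords (Vn n)) atTop (𝓝 (coords V)))
    {K : ℝ} (hτ : ∀ n, ‖coords (τ n)‖ ≤ K)
    (hW : ∀ n, Vn n + (√(n : ℝ))⁻¹ • τ n ∈ paramSpace k) :
    IsLittleOP (fun n => lawN n (Vn n)) fun n X =>
      llr (lawN n (Vn n + (√(n : ℝ))⁻¹ • τ n)) (lawN n (Vn n)) X -
        ((coords (τ n)).ofLp ⬝ᵥ (centralSeq n (Vn n) X).ofLp -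
          1 / 2 * ((coords (τ n)).ofLp ⬝ᵥ (fisherInfo V *ᵥ (coords (τ n)).ofLp))) := by
  have hprob := fun n => isProbabilityMeasure_law (hVn n)
  obtain ⟨b, w, r, C, -, h⟩ := exists_regularFamily (coords_mem_coordSpace hV)
  have hexp := h.isLittleOP_expansion (fun n => law (Vn n)) hlim
    (Eventually.of_forall fun n => law_eq (hVn n)) hτ
  refine IsLittleOP.of_abs_le hexp (Eventually.of_forall fun n => ?_)
  filter_upwards [llr_lawN (hVn n) (hW n) n] with x hx
  refine le_of_eq (congrArg _ ?_)
  -- The information identity converts the mean Hessian into minus the Fisher information.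
  rw [hx, dotProduct_centralSeq (hVn n), h.integral_hess_apply, coords_add_smul,
    dotProduct_fisherInfo_mulVec hV, integral_law hV]
  simp only [inner_score hV, sq]
  ring

end Sequences

end StudentT

theorem theorem1 (k : ℕ) (hk : 0 < k) (V : StudentT.Triple k) (hV : V ∈ StudentT.paramSpace k) :
    -- the Fisher information is finite, symmetric and non-singular
    (∀ i, MemLp (fun x => StudentT.score V x i) 2 (StudentT.law V)) ∧
    (StudentT.fisherInfo V).PosDef ∧
    ∀ Vn : ℕ → StudentT.Triple k,
      (∀ n, Vn n ∈ StudentT.paramSpace k) →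
      (fun n => StudentT.coords (Vn n) - StudentT.coords V)
        =O[atTop] (fun n : ℕ => (√(n : ℝ))⁻¹) →
      -- asymptotic normality of the central sequence
      (∃ _ : ∀ n, IsProbabilityMeasure (StudentT.lawN n (Vn n)),
        TendstoInDistribution (fun n => StudentT.centralSeq n (Vn n)) atTop id
          (fun n => StudentT.lawN n (Vn n))
          (multivariateGaussian 0 (StudentT.fisherInfo V))) ∧
      -- expansion of the log-likelihood ratio
      ∀ τ : ℕ → StudentT.Triple k,
        (∃ C : ℝ, ∀ n, ‖StudentT.coords (τ n)‖ ≤ C) →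
        (∀ n, Vn n + (√(n : ℝ))⁻¹ • τ n ∈ StudentT.paramSpace k) →
        (∀ n, StudentT.lawN n (Vn n + (√(n : ℝ))⁻¹ • τ n) ≪ StudentT.lawN n (Vn n)) ∧
        StudentT.IsLittleOP (fun n => StudentT.lawN n (Vn n)) fun n X =>
          llr (StudentT.lawN n (Vn n + (√(n : ℝ))⁻¹ • τ n)) (StudentT.lawN n (Vn n)) X -
            ((StudentT.coords (τ n)).ofLp ⬝ᵥ (StudentT.centralSeq n (Vn n) X).ofLp -
              1 / 2 * ((StudentT.coords (τ n)).ofLp ⬝ᵥ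
                (StudentT.fisherInfo V *ᵥ (StudentT.coords (τ n)).ofLp))) := by
  refine ⟨StudentT.memLp_score hV, StudentT.fisherInfo_posDef hk hV, fun Vn hVn hO => ?_⟩
  -- The rate enters only through convergence of the parameters.
  have hlim : Tendsto (fun n => StudentT.coords (Vn n)) atTop (𝓝 (StudentT.coords V)) :=
    tendsto_sub_nhds_zero_iff.1 (hO.trans_tendsto StudentT.tendsto_inv_sqrt_natCast)
  have hprob := fun n => StudentT.isProbabilityMeasure_law (hVn n)
  refine ⟨⟨fun n => ?_, StudentT.tendstoInDistribution_centralSeq hk hV hVn hlim⟩,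
    fun τ ⟨C, hC⟩ hW => ⟨fun n => StudentT.lawN_absolutelyContinuous (hVn n) (hW n) n,
      StudentT.isLittleOP_llr_sub hV hVn hlim hC hW⟩⟩
  unfold StudentT.lawN
  infer_instance
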